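/- **Corollary 2.3 (uniform discrete Carleman estimate with a potential).** Let $T>0$, $\beta\in(0,1)$, $x^0<0$ and $m>0$, and let $C_0>0$ be such that $$\psi(t,x)=|x-x^0|^2-\beta t^2+C_0\ \ge 1\quad\text{for all }(t,x)\in[-T,T]\times[0,1].$$ For $\lambda>0$ set $\varphi(t,x)=e^{\lambda\psi(t,x)}$. For $N\in\mathbb N$ let $h=1/(N+1)$ and $x_j=jh$ $(0\le j\le N+1)$. For discrete functions $f=(f_j)_{0\le j\le N+1}$ write $$\int_{(0,1)}f=h\sum_{j=1}^N f_j,\quad \int_{[0,1)}f=h\sum_{j=0}^N f_j,\quad (\partial_h^+f)_j=(\partial_h^-f)_{j+1}=\frac{f_{j+1}-f_j}{h},\quad (\Delta_hf)_j=\frac{f_{j+1}-2f_j+f_{j-1}}{h^2},$$ and let $\varphi$ also denote its restriction $(\varphi(t,x_j))_j$ to the grid. Then there exist $s_0>0$, $\lambda>0$, $\varepsilon>0$, $h_0>0$ and $M>0$, depending only on $T,\beta,x^0,C_0,m$ (in particular not on $h$, $s$, $q_h$ or $w_h$), such that the following holds for all $h=1/(N+1)\in(0,h_0)$, all real potentials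 $q_h=(q_{j,h})_{1\le j\le N}$ with $\|q_h\|_{L^\infty_h(0,1)}=\sup_{1\le j\le N}|q_{j,h}|\le m$, and all $s\in(s_0,\varepsilon/h)$. Put $L_h[q_h]w_h=\partial_{tt}w_h-\Delta_hw_h+q_hw_h$. For every real-valued $w_h=(w_{j,h}(t))_{0\le j\le N+1}$, $t\in[-T,T]$, such that, for $1\le j\le N$, $w_{j,h}$ is $C^1$ on $[-T,T]$ with $\partial_tw_{j,h}$ absolutely continuous, and such that $$\begin{cases}(L_h[q_h]w_h)_j\in L^2(-T,T), & 1\le j\le N,\\ w_{0,h}(t)=w_{N+1,h}(t)=0, & t\in(-T,T),\\ w_{j,h}(\pm T)=\partial_tw_{j,h}(\pm T)=0, & 1\le j\le N,\end{cases}$$ one has $$\begin{aligned} &s\int_{-T}^T\!\int_{(0,1)}e^{2s\varphi}|\partial_tw_h|^2\,dt+s\int_{-T}^T\!\int_{[0,1)}e^{2s\varphi}|\partial_h^+w_h|^2\,dt+s^3\int_{-T}^T\!\int_{(0,1)}e^{2s\varphi}|w_h|^2\,dt\\ &\quad\le M\int_{-T}^T\!\int_{(0,1)}e^{2s\varphi}|L_h[q_h]w_h|^2\,dt+Ms\int_{-T}^Te^{2s\varphi(t,1)}\left|(\partial_h^-w_h)_{N+1}\right|^2dt+Ms\int_{-T}^T\!\int_{[0,1)}e^{2s\varphi}|h\,\partial_h^+\partial_tw_h|^2\,dt.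 \end{aligned}$$ -/

import Mathlib

open MeasureTheory Set

namespace DiscreteCarleman

/-- The mesh size `h = 1 / (N + 1)`; the grid points are `x_j = j h`, `0 ≤ j ≤ N + 1`. -/
noncomputable def meshSize (N : ℕ) : ℝ := 1 / ((N : ℝ) + 1)

/-! A discrete function on the grid is represented by a map `v : ℕ → ℝ`, of which only the values
`v 0, …, v (N + 1)` are ever used. -/

/-- The discrete integral over `(0,1)`: `h ∑_{j=1}^{N} f_j`. -/
noncomputable def intOpen (N : ℕ) (f : ℕ → ℝ) : ℝ :=
  meshSize N * ∑ j ∈ Finset.Icc 1 N, f j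

/-- The discrete integral over `[0,1)`: `h ∑_{j=0}^{N} f_j`. -/
noncomputable def intLeft (N : ℕ) (f : ℕ → ℝ) : ℝ :=
  meshSize N * ∑ j ∈ Finset.Icc 0 N, f j

/-- The norm of `L^∞_h(0,1)`: the supremum of `|q_j|` over `1 ≤ j ≤ N`. -/
noncomputable def normLinf (N : ℕ) (q : ℕ → ℝ) : ℝ :=
  ⨆ j : Finset.Icc 1 N, |q j|

/-- The forward difference `(∂_h^+ v)_j = (v_{j+1} - v_j) / h`. -/
noncomputable def dPlus (h : ℝ) (v : ℕ → ℝ) (j : ℕ) : ℝ := (v (j + 1) - v j) / h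

/-- The backward difference `(∂_h^- v)_j = (v_j - v_{j-1}) / h`, used for `j ≥ 1` only. -/
noncomputable def dMinus (h : ℝ) (v : ℕ → ℝ) (j : ℕ) : ℝ := (v j - v (j - 1)) / h

/-- The discrete Laplacian `(Δ_h v)_j = (v_{j+1} - 2 v_j + v_{j-1}) / h²`,
used for `j ≥ 1` only. -/
noncomputable def laplacian (h : ℝ) (v : ℕ → ℝ) (j : ℕ) : ℝ :=
  (v (j + 1) - 2 * v j + v (j - 1)) / h ^ 2

/-- The time derivative on `[-T, T]` (one-sided at `t = ±T`). -/
noncomputable def dt (T : ℝ) (f : ℝ → ℝ) (t : ℝ) : ℝ := derivWithin f (Icc (-T) T) t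

/-- The weight `ψ(t,x) = |x - x⁰|² - β t² + C₀`. -/
noncomputable def psi (x0 β C0 t x : ℝ) : ℝ := |x - x0| ^ 2 - β * t ^ 2 + C0

/-- The weight `φ(t,x) = exp (λ ψ(t,x))`. -/
noncomputable def phi (x0 β C0 lam t x : ℝ) : ℝ := Real.exp (lam * psi x0 β C0 t x)

/-- The semi-discrete wave operator with potential,
`(L_h[q_h] w_h)_j(t) = ∂_tt w_j(t) - (Δ_h w(t))_j + q_j w_j(t)`, for `1 ≤ j ≤ N`. -/
noncomputable def waveOp (N : ℕ) (T : ℝ) (q : ℕ → ℝ) (w : ℕ → ℝ → ℝ) (j : ℕ) (t : ℝ) : ℝ :=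
  dt T (dt T (w j)) t - laplacian (meshSize N) (fun i => w i t) j + q j * w j t

/-- The semi-discrete functions `w_h` to which the estimate applies. The fields `contDiffOn` and
`absCont` give `∂_tt w_h` its meaning: each `w_j` is `C¹` on `[-T,T]` and `∂_t w_j` is absolutely
continuous, so that `∂_tt w_j` exists almost everywhere and is the distributional derivative of
`∂_t w_j`. Together with `memLp` this says `w_j ∈ H²(-T,T)`. Membership in
`L²(-T,T; L²_h(0,1))` is membership of the `N` components in `L²(-T,T)`. -/
structure Admissible (N : ℕ) (T : ℝ) (q : ℕ → ℝ) (w : ℕ → ℝ → ℝ) : Prop where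
  contDiffOn : ∀ j ∈ Finset.Icc 1 N, ContDiffOn ℝ 1 (w j) (Icc (-T) T)
  absCont : ∀ j ∈ Finset.Icc 1 N, AbsolutelyContinuousOnInterval (dt T (w j)) (-T) T
  memLp : ∀ j ∈ Finset.Icc 1 N,
    MemLp (fun t => waveOp N T q w j t) 2 (volume.restrict (Ioo (-T) T))
  boundary_left : ∀ t ∈ Ioo (-T) T, w 0 t = 0
  boundary_right : ∀ t ∈ Ioo (-T) T, w (N + 1) t = 0
  initial : ∀ j ∈ Finset.Icc 1 N, w j (-T) = 0
  final : ∀ j ∈ Finset.Icc 1 N, w j T = 0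
  initial_dt : ∀ j ∈ Finset.Icc 1 N, dt T (w j) (-T) = 0
  final_dt : ∀ j ∈ Finset.Icc 1 N, dt T (w j) T = 0

end DiscreteCarleman

namespace DiscreteCarleman

/-! ### Summation by parts -/

/-! The multiplier proof of the continuous Carleman estimate is carried over to the grid. Put z =
e^{sφ} w and u = ∂ₜz. By `conjugated_operator`, e^{sφ} L_h w = P + 2Q + R with P = ∂ₜₜz - A Δ_h z +
s² V z and Q = s b D z - s φₜ u, where D is the centred difference and R has size s|z|. Since 8PQ ≤
(P + 2Q)² ≤ 2 (e^{sφ} L_h w)² + 2R², it suffices to bound ∑ PQ from below.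

`multiplier_identity` computes this sum exactly: the time derivative of a flux, a quadratic form in
(∂ₜz, ∂ₕz), a quadratic form in z, boundary terms, and two discretisation errors. The errors arise
because summation by parts produces u_j u_{j+1} and z_j z_{j+1} instead of squares. The first is a
multiple of (u_{j+1} - u_j)² with the unfavourable sign; at the highest grid frequencies it is as
large as the main terms, and it is the source of the last term of the estimate. The second carries
s³h² = s (sh)² and is absorbed when sh is small.

The coefficients A, b, V are smooth functions of (σ, t, x), σ = sh, up to and including σ = 0. For
small sh and h the two forms are therefore uniformly close to their continuous limits, which are
coercive by `gradient_pseudoconvex` and `potential_pseudoconvex`. This explains the restriction s <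
ε/h. Taking s large absorbs R, potential included, into s³|z|².

The boundary term at x = 0 has a good sign because x⁰ < 0, and the one at x = 1 is the observation.
The flux integrates to zero in time since w and ∂ₜw vanish at ±T. -/

theorem sum_shift_mul_centered (b u : ℕ → ℝ) (N : ℕ) :
    ∑ j ∈ Finset.range N, b (j + 1) * u (j + 1) * (u (j + 2) - u j)
      + ∑ j ∈ Finset.range (N + 1), (b (j + 1) - b j) * (u j * u (j + 1))
      = b (N + 1) * u N * u (N + 1) - b 0 * u 0 * u 1 := by
  induction N with
  | zero => simp; ring
  | succ n ih =>
    rw [Finset.sum_range_succ, Finset.sum_range_succ _ (n + 1)]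
    linear_combination ih

theorem sum_mul_second_difference (f z : ℕ → ℝ) (N : ℕ) :
    ∑ j ∈ Finset.range N, f (j + 1) * (z (j + 2) - 2 * z (j + 1) + z j)
      + ∑ j ∈ Finset.range (N + 1), (f (j + 1) - f j) * (z (j + 1) - z j)
      = f (N + 1) * (z (N + 1) - z N) - f 0 * (z 1 - z 0) := by
  induction N with
  | zero => simp; ring
  | succ n ih =>
    rw [Finset.sum_range_succ, Finset.sum_range_succ _ (n + 1)]
    linear_combination ih

theorem sum_mul_difference_sq (g d : ℕ → ℝ) (N : ℕ) :
    ∑ j ∈ Finset.range N, g (j + 1) * (d (j + 1) ^ 2 - d j ^ 2)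
      + ∑ j ∈ Finset.range (N + 1), (g (j + 1) - g j) * d j ^ 2
      = g (N + 1) * d N ^ 2 - g 0 * d 0 ^ 2 := by
  induction N with
  | zero => simp; ring
  | succ n ih =>
    rw [Finset.sum_range_succ, Finset.sum_range_succ _ (n + 1)]
    linear_combination ih

theorem sum_nodes_eq_sum_intervals (f : ℕ → ℝ) (N : ℕ) (h0 : f 0 = 0) (h1 : f (N + 1) = 0) :
    ∑ j ∈ Finset.range N, f (j + 1)
      = ∑ j ∈ Finset.range (N + 1), (f j + f (j + 1)) / 2 := by
  have key : ∀ n : ℕ, ∑ j ∈ Finset.range n, f (j + 1) + (f 0 + f (n + 1)) / 2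
      = ∑ j ∈ Finset.range (n + 1), (f j + f (j + 1)) / 2 := by
    intro n
    induction n with
    | zero => simp
    | succ n ih =>
      rw [Finset.sum_range_succ, Finset.sum_range_succ _ (n + 1)]
      linear_combination ih
  rw [← key, h0, h1]; ring

/-! ### The multiplier identity -/

/-- Time derivative of the nodal part of the energy flux. -/
noncomputable def fluxNodeDeriv (h : ℝ) (z u v b τ W b' τ' W' : ℕ → ℝ) (j : ℕ) : ℝ :=
  -(τ' (j + 1) * u (j + 1) ^ 2) / 2 - τ (j + 1) * u (j + 1) * v (j + 1)
    + b' (j + 1) * u (j + 1) * ((z (j + 2) - z j) / (2 * h))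
    + b (j + 1) * v (j + 1) * ((z (j + 2) - z j) / (2 * h))
    + b (j + 1) * u (j + 1) * ((u (j + 2) - u j) / (2 * h))
    - W' (j + 1) * z (j + 1) ^ 2 / 2 - W (j + 1) * z (j + 1) * u (j + 1)

/-- Time derivative of the part of the energy flux living on the mesh intervals. -/
noncomputable def fluxIntervalDeriv (h : ℝ) (z u B B' : ℕ → ℝ) (j : ℕ) : ℝ :=
  -((B' j + B' (j + 1)) / 4 * dPlus h z j ^ 2)
    - (B j + B (j + 1)) / 2 * dPlus h z j * dPlus h u j

/-- The quadratic form in `(∂ₜz, ∂ₕz)` on one mesh interval. -/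
noncomputable def gradForm (h : ℝ) (b B G b' τ' B' : ℕ → ℝ) (j : ℕ) (α α' d : ℝ) : ℝ :=
  (τ' j * α ^ 2 + τ' (j + 1) * α' ^ 2) / 4 + dPlus h b j * (α ^ 2 + α' ^ 2) / 4
    - (b' j * α + b' (j + 1) * α') * d / 2 - dPlus h B j * (α + α') * d / 2
    + (B' j + B' (j + 1)) / 4 * d ^ 2 + dPlus h G j * d ^ 2 / 2

/-- The quadratic form in `z` on one mesh interval. -/
noncomputable def zeroForm (h : ℝ) (H W' : ℕ → ℝ) (j : ℕ) (ζ ζ' : ℝ) : ℝ :=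
  (W' j * ζ ^ 2 + W' (j + 1) * ζ' ^ 2) / 4 - dPlus h H j * (ζ ^ 2 + ζ' ^ 2) / 4

/-- Discrete version of multiplying the wave operator by b ∂ₓz - τ ∂ₜz. It is pure algebra at a
fixed time: v stands for ∂ₜₜz, u for ∂ₜz, and the primed sequences for time derivatives of
coefficients. The primed sequences are arbitrary, since each occurs in a flux derivative and, with
the opposite sign, in a form. The last two terms of the interval sum come from u_j u_{j+1} = (u_j² +
u_{j+1}²)/2 - (u_{j+1} - u_j)²/2 and the same formula for z. -/
theorem multiplier_identity (N : ℕ) {h : ℝ} (hh : h ≠ 0) (z u v A b V τ b' τ' B' W' : ℕ → ℝ)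
    (hz0 : z 0 = 0) (hz1 : z (N + 1) = 0) (hu0 : u 0 = 0) (hu1 : u (N + 1) = 0) :
    ∑ j ∈ Finset.range N,
        (v (j + 1) - A (j + 1) * laplacian h z (j + 1) + V (j + 1) * z (j + 1))
          * (b (j + 1) * ((z (j + 2) - z j) / (2 * h)) - τ (j + 1) * u (j + 1))
      = ∑ j ∈ Finset.range N, fluxNodeDeriv h z u v b τ (V * τ) b' τ' W' j
        + ∑ j ∈ Finset.range (N + 1), fluxIntervalDeriv h z u (A * τ) B' j
        + ∑ j ∈ Finset.range (N + 1),
            (gradForm h b (A * τ) (A * b) b' τ' B' j (u j) (u (j + 1)) (dPlus h z j)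
              + zeroForm h (V * b) W' j (z j) (z (j + 1))
              - dPlus h b j * (u (j + 1) - u j) ^ 2 / 4
              + h ^ 2 * dPlus h (V * b) j * dPlus h z j ^ 2 / 4)
        + (A 0 * b 0 * dPlus h z 0 ^ 2 - A (N + 1) * b (N + 1) * dPlus h z N ^ 2) / (2 * h) := by
  have e1 := sum_shift_mul_centered b u N
  have e2 := sum_shift_mul_centered (V * b) z N
  have e3 := sum_mul_second_difference (A * τ * u) z N
  have e4 := sum_mul_difference_sq (A * b) (dPlus h z) N
  have e5 := sum_nodes_eq_sum_intervals (fun j => τ' j * u j ^ 2) N (by simp [hu0]) (by simp [hu1])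
  have e6 := sum_nodes_eq_sum_intervals (fun j => W' j * z j ^ 2) N (by simp [hz0]) (by simp [hz1])
  have e7 : ∑ j ∈ Finset.range N, b' (j + 1) * u (j + 1) * ((z (j + 2) - z j) / (2 * h))
      = ∑ j ∈ Finset.range (N + 1), (b' j * u j + b' (j + 1) * u (j + 1)) * dPlus h z j / 2 := by
    -- The end contributions are kept so that the induction closes; they vanish afterwards because u
    -- is zero at both end nodes.
    have key : ∀ n : ℕ, ∑ j ∈ Finset.range n, b' (j + 1) * u (j + 1) * ((z (j + 2) - z j) / (2 * h))
        + b' 0 * u 0 * dPlus h z 0 / 2 + b' (n + 1) * u (n + 1) * dPlus h z n / 2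
        = ∑ j ∈ Finset.range (n + 1), (b' j * u j + b' (j + 1) * u (j + 1)) * dPlus h z j / 2 := by
      intro n
      induction n with
      | zero => simp; ring
      | succ n ih =>
        rw [Finset.sum_range_succ, Finset.sum_range_succ _ (n + 1), ← ih]
        simp only [dPlus]; field_simp; ring
    have := key N
    rw [hu0, hu1] at this
    linarith
  simp only [Pi.mul_apply, hz0, hz1, hu0, hu1, mul_zero, zero_mul, sub_zero, sub_self] at e1 e2 e3 e4
  have l : ∑ j ∈ Finset.range N,
        (v (j + 1) - A (j + 1) * laplacian h z (j + 1) + V (j + 1) * z (j + 1))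
          * (b (j + 1) * ((z (j + 2) - z j) / (2 * h)) - τ (j + 1) * u (j + 1))
      = ∑ j ∈ Finset.range N, fluxNodeDeriv h z u v b τ (V * τ) b' τ' W' j
        + (∑ j ∈ Finset.range N, τ' (j + 1) * u (j + 1) ^ 2) / 2
        + (∑ j ∈ Finset.range N, W' (j + 1) * z (j + 1) ^ 2) / 2
        - ∑ j ∈ Finset.range N, b' (j + 1) * u (j + 1) * ((z (j + 2) - z j) / (2 * h))
        - (∑ j ∈ Finset.range N, b (j + 1) * u (j + 1) * (u (j + 2) - u j)) / (2 * h)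
        + (∑ j ∈ Finset.range N, V (j + 1) * b (j + 1) * z (j + 1) * (z (j + 2) - z j)) / (2 * h)
        + (∑ j ∈ Finset.range N, A (j + 1) * τ (j + 1) * u (j + 1)
            * (z (j + 2) - 2 * z (j + 1) + z j)) / h ^ 2
        - (∑ j ∈ Finset.range N, A (j + 1) * b (j + 1)
            * (dPlus h z (j + 1) ^ 2 - dPlus h z j ^ 2)) / (2 * h) := by
    simp only [Finset.sum_div, ← Finset.sum_add_distrib, ← Finset.sum_sub_distrib]
    refine Finset.sum_congr rfl fun j _ => ?_
    simp only [fluxNodeDeriv, laplacian, dPlus, Pi.mul_apply, Nat.add_sub_cancel]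
    field_simp
    ring
  rw [l, eq_sub_of_add_eq e1, eq_sub_of_add_eq e2, eq_sub_of_add_eq e3, eq_sub_of_add_eq e4, e5, e6,
    e7]
  have r : ∑ j ∈ Finset.range (N + 1), fluxIntervalDeriv h z u (A * τ) B' j
        + ∑ j ∈ Finset.range (N + 1),
            (gradForm h b (A * τ) (A * b) b' τ' B' j (u j) (u (j + 1)) (dPlus h z j)
              + zeroForm h (V * b) W' j (z j) (z (j + 1))
              - dPlus h b j * (u (j + 1) - u j) ^ 2 / 4
              + h ^ 2 * dPlus h (V * b) j * dPlus h z j ^ 2 / 4)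
      = (∑ j ∈ Finset.range (N + 1), (τ' j * u j ^ 2 + τ' (j + 1) * u (j + 1) ^ 2) / 2) / 2
        + (∑ j ∈ Finset.range (N + 1), (W' j * z j ^ 2 + W' (j + 1) * z (j + 1) ^ 2) / 2) / 2
        - ∑ j ∈ Finset.range (N + 1), (b' j * u j + b' (j + 1) * u (j + 1)) * dPlus h z j / 2
        + (∑ j ∈ Finset.range (N + 1), (b (j + 1) - b j) * (u j * u (j + 1))) / (2 * h)
        - (∑ j ∈ Finset.range (N + 1),
            (V (j + 1) * b (j + 1) - V j * b j) * (z j * z (j + 1))) / (2 * h)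
        - (∑ j ∈ Finset.range (N + 1), (A (j + 1) * τ (j + 1) * u (j + 1) - A j * τ j * u j)
            * (z (j + 1) - z j)) / h ^ 2
        + (∑ j ∈ Finset.range (N + 1),
            (A (j + 1) * b (j + 1) - A j * b j) * dPlus h z j ^ 2) / (2 * h) := by
    simp only [Finset.sum_div, ← Finset.sum_add_distrib, ← Finset.sum_sub_distrib]
    refine Finset.sum_congr rfl fun j _ => ?_
    simp only [fluxIntervalDeriv, gradForm, zeroForm, dPlus, Pi.mul_apply]
    field_simp
    ring
  linear_combination -r

/-! ### Conjugation with the weight -/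

theorem abs_exp_sub_exp_le {x y R : ℝ} (hx : x ≤ R) (hy : y ≤ R) :
    |Real.exp x - Real.exp y| ≤ Real.exp R * |x - y| := by
  have key : ∀ a b : ℝ, a ≤ R → b ≤ a → Real.exp a - Real.exp b ≤ Real.exp R * (a - b) := by
    intro a b ha hab
    have h1 : Real.exp a - Real.exp b = Real.exp a * (1 - Real.exp (b - a)) := by
      rw [mul_sub, ← Real.exp_add]; ring_nf
    have h2 := Real.add_one_le_exp (b - a)
    rw [h1]
    exact mul_le_mul (Real.exp_le_exp.2 ha) (by linarith)
      (by have := Real.exp_le_one_iff.2 (sub_nonpos.2 hab); linarith) (Real.exp_pos _).le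
  rcases le_total y x with hyx | hyx
  · rw [abs_of_nonneg (sub_nonneg.2 (Real.exp_le_exp.2 hyx)), abs_of_nonneg (sub_nonneg.2 hyx)]
    exact key x y hx hyx
  · rw [abs_sub_comm, abs_sub_comm x, abs_of_nonneg (sub_nonneg.2 (Real.exp_le_exp.2 hyx)),
      abs_of_nonneg (sub_nonneg.2 hyx)]
    exact key y x hy hyx

/-- The neighbours enter through e^{s(f1-f2)} and e^{s(f1-f0)}, which are replaced by e^{∓sh fx} = A
∓ sh b. The even part A gives the Laplacian and the zeroth order term 2(A - 1)/h², hence V; the odd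
part b gives the centred difference. The cost of the replacement goes into the last, lower order
term. Using the exact derivative `fx` makes the coefficients functions of (sh, t, x) alone. -/
theorem conjugated_operator {s h f0 f1 f2 ft ftt fx A b V q y0 y1 y2 y1' y1'' : ℝ} (hh : h ≠ 0)
    (hA : A = Real.cosh (s * h * fx)) (hb : s * h * b = Real.sinh (s * h * fx))
    (hV : (s * h) ^ 2 * (ft ^ 2 - V) = 2 * (A - 1)) :
    Real.exp (s * f1) * (y1'' - (y2 - 2 * y1 + y0) / h ^ 2 + q * y1)
      = (Real.exp (s * f1) * (y1'' + 2 * (s * ft) * y1' + (s * ftt + (s * ft) ^ 2) * y1)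
          - A * ((Real.exp (s * f2) * y2 - 2 * (Real.exp (s * f1) * y1) + Real.exp (s * f0) * y0)
              / h ^ 2)
          + s ^ 2 * V * (Real.exp (s * f1) * y1))
        + 2 * (s * b * ((Real.exp (s * f2) * y2 - Real.exp (s * f0) * y0) / (2 * h))
          - s * ft * (Real.exp (s * f1) * (y1' + s * ft * y1)))
        + ((q - s * ftt) * (Real.exp (s * f1) * y1)
          - ((Real.exp (s * (f1 - f2)) - Real.exp (-(s * h * fx))) * (Real.exp (s * f2) * y2)
            + (Real.exp (s * (f1 - f0)) - Real.exp (s * h * fx)) * (Real.exp (s * f0) * y0))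
            / h ^ 2) := by
  have e1 : Real.exp (s * (f1 - f2)) * Real.exp (s * f2) = Real.exp (s * f1) := by
    rw [← Real.exp_add]; ring_nf
  have e2 : Real.exp (s * (f1 - f0)) * Real.exp (s * f0) = Real.exp (s * f1) := by
    rw [← Real.exp_add]; ring_nf
  have e3 : Real.exp (-(s * h * fx)) = A - s * h * b := by
    rw [hA, hb, Real.cosh_sub_sinh]
  have e4 : Real.exp (s * h * fx) = A + s * h * b := by
    rw [hA, hb, Real.cosh_add_sinh]
  rw [e3, e4]
  field_simp
  linear_combination (Real.exp (s * f1) * y1) * hV + y2 * e1 + y0 * e2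

/-- The bounds on the weight `f`, its derivatives and the coefficients of the conjugated operator
on the grid at a fixed time, as needed for the pointwise-in-time Carleman inequality. -/
structure WeightBounds (N : ℕ) (h s K c : ℝ) (f ft ftt fx A b V b' B' W' : ℕ → ℝ) : Prop where
  cosh_eq : ∀ j, A j = Real.cosh (s * h * fx j)
  sinh_eq : ∀ j, s * h * b j = Real.sinh (s * h * fx j)
  pot_eq : ∀ j, (s * h) ^ 2 * (ft j ^ 2 - V j) = 2 * (A j - 1)
  abs_ft : ∀ j ≤ N + 1, |ft j| ≤ K
  abs_ftt : ∀ j ≤ N + 1, |ftt j| ≤ K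
  abs_fx : ∀ j ≤ N + 1, |fx j| ≤ K
  lip_f : ∀ j ≤ N, |f (j + 1) - f j| ≤ K * h
  lip_ft : ∀ j ≤ N, |ft (j + 1) - ft j| ≤ K * h
  taylor_right : ∀ j ≤ N, |f (j + 1) - f j - h * fx j| ≤ K * h ^ 2
  taylor_left : ∀ j ≤ N, |f (j + 1) - f j - h * fx (j + 1)| ≤ K * h ^ 2
  grad : ∀ j ≤ N, ∀ α α' d : ℝ,
    c * (α ^ 2 + α' ^ 2 + d ^ 2) ≤ gradForm h b (A * ft) (A * b) b' ftt B' j α α' d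
  zero : ∀ j ≤ N, ∀ ζ ζ' : ℝ, c * (ζ ^ 2 + ζ' ^ 2) ≤ zeroForm h (V * b) W' j ζ ζ'
  abs_diff_b : ∀ j ≤ N, |dPlus h b j| ≤ K
  abs_diff_Vb : ∀ j ≤ N, |dPlus h (V * b) j| ≤ K
  left_nonneg : 0 ≤ A 0 * b 0
  right_le : A (N + 1) * b (N + 1) ≤ K

/-! ### Conjugation errors at a node -/

section Pointwise

variable {N : ℕ} {h s K c : ℝ} {f ft ftt fx A b V b' B' W' : ℕ → ℝ}

/-- The exponents differ by s times a second order Taylor remainder, and both are at most K because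
sh ≤ 1. After division by h² the error is of order s only. -/
theorem WeightBounds.abs_exp_right_le (hW : WeightBounds N h s K c f ft ftt fx A b V b' B' W')
    (hK : 0 ≤ K) (hh : 0 < h) (hs : 0 < s) (hsh : s * h ≤ 1) {j : ℕ} (hj : j ≤ N) :
    |Real.exp (s * (f j - f (j + 1))) - Real.exp (-(s * h * fx j))|
      ≤ K * Real.exp K * s * h ^ 2 := by
  have hσ : 0 ≤ s * h := by positivity
  have b1 := abs_le.1 (hW.lip_f j hj)
  have b2 := abs_le.1 (hW.abs_fx j (by omega))
  refine (abs_exp_sub_exp_le (R := K) ?_ ?_).trans ?_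
  · nlinarith [mul_le_mul_of_nonneg_left b1.1 hs.le, mul_le_mul_of_nonneg_right hsh hK]
  · nlinarith [mul_le_mul_of_nonneg_left b2.1 hσ, mul_le_mul_of_nonneg_right hsh hK]
  · have : s * (f j - f (j + 1)) - -(s * h * fx j) = -(s * (f (j + 1) - f j - h * fx j)) := by ring
    rw [this, abs_neg, abs_mul, abs_of_pos hs]
    have := mul_le_mul_of_nonneg_left (hW.taylor_right j hj) (mul_nonneg (Real.exp_pos K).le hs.le)
    linarith

theorem WeightBounds.abs_exp_left_le (hW : WeightBounds N h s K c f ft ftt fx A b V b' B' W')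
    (hK : 0 ≤ K) (hh : 0 < h) (hs : 0 < s) (hsh : s * h ≤ 1) {j : ℕ} (hj : j ≤ N) :
    |Real.exp (s * (f (j + 1) - f j)) - Real.exp (s * h * fx (j + 1))|
      ≤ K * Real.exp K * s * h ^ 2 := by
  have hσ : 0 ≤ s * h := by positivity
  have b1 := abs_le.1 (hW.lip_f j hj)
  have b2 := abs_le.1 (hW.abs_fx (j + 1) (by omega))
  refine (abs_exp_sub_exp_le (R := K) ?_ ?_).trans ?_
  · nlinarith [mul_le_mul_of_nonneg_left b1.2 hs.le, mul_le_mul_of_nonneg_right hsh hK]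
  · nlinarith [mul_le_mul_of_nonneg_left b2.2 hσ, mul_le_mul_of_nonneg_right hsh hK]
  · have : s * (f (j + 1) - f j) - s * h * fx (j + 1)
        = s * (f (j + 1) - f j - h * fx (j + 1)) := by ring
    rw [this, abs_mul, abs_of_pos hs]
    have := mul_le_mul_of_nonneg_left (hW.taylor_left j hj) (mul_nonneg (Real.exp_pos K).le hs.le)
    linarith

theorem WeightBounds.abs_exp_sub_one_le (hW : WeightBounds N h s K c f ft ftt fx A b V b' B' W')
    (hK : 0 ≤ K) (hs : 0 < s) (hsh : s * h ≤ 1) {j : ℕ} (hj : j ≤ N) :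
    |Real.exp (s * (f j - f (j + 1))) - 1| ≤ K * Real.exp K * (s * h) := by
  have b1 := abs_le.1 (hW.lip_f j hj)
  rw [← Real.exp_zero]
  refine (abs_exp_sub_exp_le (R := K) ?_ hK).trans ?_
  · nlinarith [mul_le_mul_of_nonneg_left b1.1 hs.le, mul_le_mul_of_nonneg_right hsh hK]
  · rw [sub_zero, abs_mul, abs_of_pos hs, abs_sub_comm]
    have := mul_le_mul_of_nonneg_left (hW.lip_f j hj) (mul_nonneg (Real.exp_pos K).le hs.le)
    linarith

/-- The conjugated unknown `e^{sf} w`. -/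
noncomputable def conj₀ (s : ℝ) (f w : ℕ → ℝ) (j : ℕ) : ℝ := Real.exp (s * f j) * w j

/-- The time derivative of the conjugated unknown. -/
noncomputable def conj₁ (s : ℝ) (f ft w w₁ : ℕ → ℝ) (j : ℕ) : ℝ :=
  Real.exp (s * f j) * (w₁ j + s * ft j * w j)

/-- The second time derivative of the conjugated unknown. -/
noncomputable def conj₂ (s : ℝ) (f ft ftt w w₁ w₂ : ℕ → ℝ) (j : ℕ) : ℝ :=
  Real.exp (s * f j) * (w₂ j + 2 * (s * ft j) * w₁ j + (s * ftt j + (s * ft j) ^ 2) * w j)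

theorem sq_le_three_mul {R a x y z : ℝ} (h : |R| ≤ a * (|x| + |y| + |z|)) :
    R ^ 2 ≤ 3 * a ^ 2 * (x ^ 2 + y ^ 2 + z ^ 2) := by
  have h1 : R ^ 2 ≤ (a * (|x| + |y| + |z|)) ^ 2 := by
    rw [← sq_abs R]; exact pow_le_pow_left₀ (abs_nonneg R) h 2
  have h2 : (|x| + |y| + |z|) ^ 2 ≤ 3 * (x ^ 2 + y ^ 2 + z ^ 2) := by
    rw [← sq_abs x, ← sq_abs y, ← sq_abs z]
    nlinarith [sq_nonneg (|x| - |y|), sq_nonneg (|x| - |z|), sq_nonneg (|y| - |z|)]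
  nlinarith [mul_le_mul_of_nonneg_left h2 (sq_nonneg a)]

/-- The remainder of the conjugation at an interior node is of lower order. -/
theorem WeightBounds.abs_remainder_le
    (hW : WeightBounds N h s K c f ft ftt fx A b V b' B' W')
    {m : ℝ} (hm : 0 ≤ m) (hK : 0 ≤ K) (hh : 0 < h) (hs : 1 ≤ s) (hsh : s * h ≤ 1)
    {q : ℝ} (z₀ z₁ z₂ : ℝ) {j : ℕ} (hj : j < N) (hq : |q| ≤ m) :
    |(q - s * ftt (j + 1)) * z₁
        - ((Real.exp (s * (f (j + 1) - f (j + 1 + 1))) - Real.exp (-(s * h * fx (j + 1)))) * z₂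
          + (Real.exp (s * (f (j + 1) - f j)) - Real.exp (s * h * fx (j + 1))) * z₀) / h ^ 2|
      ≤ (K * Real.exp K + m) * s * (|z₀| + |z₁| + |z₂|) := by
  have hs0 : 0 < s := by linarith
  have r1 := hW.abs_exp_right_le hK hh hs0 hsh (j := j + 1) (by omega)
  have r2 := hW.abs_exp_left_le hK hh hs0 hsh (j := j) (by omega)
  have r3 := hW.abs_ftt (j + 1) (by omega)
  have eK : 1 ≤ Real.exp K := Real.one_le_exp hK
  have KK : K ≤ K * Real.exp K := le_mul_of_one_le_right hK eK
  have t1 : |q - s * ftt (j + 1)| ≤ (K * Real.exp K + m) * s := by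
    refine (abs_sub _ _).trans ?_
    rw [abs_mul, abs_of_pos hs0]
    nlinarith
  have t0 : ∀ e : ℝ, |e| ≤ K * Real.exp K * s * h ^ 2 → |e / h ^ 2| ≤ (K * Real.exp K + m) * s := by
    intro e he
    rw [abs_div, abs_of_pos (by positivity : (0 : ℝ) < h ^ 2), div_le_iff₀ (by positivity)]
    have : 0 ≤ m * s * h ^ 2 := by positivity
    linarith
  rw [add_div, mul_div_right_comm, mul_div_right_comm]
  refine (abs_sub _ _).trans ((add_le_add_right (abs_add_le _ _) _).trans ?_)
  rw [abs_mul, abs_mul, abs_mul]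
  have m1 := mul_le_mul_of_nonneg_right t1 (abs_nonneg z₁)
  have m2 := mul_le_mul_of_nonneg_right (t0 _ r1) (abs_nonneg z₂)
  have m3 := mul_le_mul_of_nonneg_right (t0 _ r2) (abs_nonneg z₀)
  linarith

/-- From (P - 2Q)² ≥ 0 one gets 8PQ ≤ (P + 2Q)², and P + 2Q = L - R. -/
theorem eight_mul_le_of_eq {P Q R L S : ℝ} (hL : L = P + 2 * Q + R) (hR : R ^ 2 ≤ S) :
    8 * (P * Q) ≤ 2 * L ^ 2 + 2 * S := by
  subst hL
  nlinarith [sq_nonneg (P - 2 * Q), sq_nonneg (P + 2 * Q + 2 * R)]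

/-- At each node, the product of the two halves of the conjugated operator is controlled by the
operator itself up to lower order terms. -/
theorem WeightBounds.eight_mul_product_le
    (hW : WeightBounds N h s K c f ft ftt fx A b V b' B' W')
    {m : ℝ} (hm : 0 ≤ m) (hK : 0 ≤ K) (hh : 0 < h) (hs : 1 ≤ s) (hsh : s * h ≤ 1)
    {q w w₁ w₂ : ℕ → ℝ} {j : ℕ} (hj : j < N) (hq : |q (j + 1)| ≤ m) :
    8 * ((conj₂ s f ft ftt w w₁ w₂ (j + 1) - A (j + 1) * laplacian h (conj₀ s f w) (j + 1)
          + s ^ 2 * V (j + 1) * conj₀ s f w (j + 1))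
        * (s * b (j + 1) * ((conj₀ s f w (j + 2) - conj₀ s f w j) / (2 * h))
          - s * ft (j + 1) * conj₁ s f ft w w₁ (j + 1)))
      ≤ 2 * (Real.exp (2 * s * f (j + 1))
          * (w₂ (j + 1) - laplacian h w (j + 1) + q (j + 1) * w (j + 1)) ^ 2)
        + 2 * (3 * ((K * Real.exp K + m) * s) ^ 2
          * (conj₀ s f w j ^ 2 + conj₀ s f w (j + 1) ^ 2 + conj₀ s f w (j + 2) ^ 2)) := by
  have key := conjugated_operator (f0 := f j) (f1 := f (j + 1)) (f2 := f (j + 1 + 1))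
    (ftt := ftt (j + 1)) (q := q (j + 1)) (y0 := w j) (y1 := w (j + 1)) (y2 := w (j + 1 + 1))
    (y1' := w₁ (j + 1)) (y1'' := w₂ (j + 1)) hh.ne' (hW.cosh_eq (j + 1)) (hW.sinh_eq (j + 1))
    (hW.pot_eq (j + 1))
  have hexp : Real.exp (2 * s * f (j + 1)) = Real.exp (s * f (j + 1)) ^ 2 := by
    rw [← Real.exp_nat_mul]; push_cast; ring_nf
  rw [hexp, ← mul_pow]
  exact eight_mul_le_of_eq key (sq_le_three_mul
    (hW.abs_remainder_le hm hK hh hs hsh _ _ _ hj hq))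

end Pointwise

/-! ### Passing between w and its conjugate; coercivity on a mesh interval -/

section Pointwise

variable {N : ℕ} {h s K c : ℝ} {f ft ftt fx A b V b' B' W' : ℕ → ℝ}

theorem exp_two_mul_eq_sq (s x : ℝ) : Real.exp (2 * s * x) = Real.exp (s * x) ^ 2 := by
  rw [← Real.exp_nat_mul]; push_cast; ring_nf

theorem exp_mul_sub_mul_exp (s x y : ℝ) :
    Real.exp (s * (x - y)) * Real.exp (s * y) = Real.exp (s * x) := by
  rw [← Real.exp_add]; ring_nf

theorem sq_le_sq_of_abs_le_mul {x y C : ℝ} (h : |x| ≤ C * |y|) : x ^ 2 ≤ C ^ 2 * y ^ 2 := by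
  rw [← sq_abs x, ← sq_abs y, ← mul_pow]
  exact pow_le_pow_left₀ (abs_nonneg x) h 2

/-- Conjugation error for the mixed difference `h ∂ₕ∂ₜ`. -/
theorem WeightBounds.sq_diff_conj₁_le (hW : WeightBounds N h s K c f ft ftt fx A b V b' B' W')
    (hK : 1 ≤ K) (hh : 0 < h) (hs : 1 ≤ s) (hsh : s * h ≤ 1) (w w₁ : ℕ → ℝ) {j : ℕ} (hj : j ≤ N) :
    (conj₁ s f ft w w₁ (j + 1) - conj₁ s f ft w w₁ j) ^ 2
      ≤ 5 * (Real.exp (2 * s * f j) * (w₁ (j + 1) - w₁ j) ^ 2)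
        + 5 * (K * Real.exp K) ^ 2 * K ^ 2 * (s * h) ^ 2
          * (conj₁ s f ft w w₁ (j + 1) ^ 2 + dPlus h (conj₀ s f w) j ^ 2
            + s ^ 2 * (conj₀ s f w j ^ 2 + conj₀ s f w (j + 1) ^ 2)) := by
  have hs0 : 0 < s := by linarith
  have hK0 : 0 < K := by linarith
  set e := Real.exp (s * (f j - f (j + 1))) with he
  have hee : e * Real.exp (s * f (j + 1)) = Real.exp (s * f j) := exp_mul_sub_mul_exp ..
  set L := K * Real.exp K with hL
  have hL1 : 1 ≤ L := one_le_mul_of_one_le_of_one_le hK (Real.one_le_exp hK0.le)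
  have hKL : K ≤ L := le_mul_of_one_le_right hK0.le (Real.one_le_exp hK0.le)
  have heb : |1 - e| ≤ L * (s * h) := by
    rw [abs_sub_comm]; exact hW.abs_exp_sub_one_le hK0.le hs0 hsh hj
  set z := conj₀ s f w with hz
  set u := conj₁ s f ft w w₁ with hu
  -- The weight is frozen at the left node. Every term after the first is of order sh times one of
  -- u, d, s z, using s ≥ 1 for the last one.
  have hsplit : u (j + 1) - u j = Real.exp (s * f j) * (w₁ (j + 1) - w₁ j) + (1 - e) * u (j + 1)
      - (1 - e) * (s * ft (j + 1)) * z (j + 1) + s * ft (j + 1) * h * dPlus h z j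
      + s * (ft (j + 1) - ft j) * z j := by
    simp only [hz, hu, conj₀, conj₁, dPlus]
    field_simp
    linear_combination w₁ (j + 1) * hee
  have hσ : 0 < s * h := by positivity
  have a1 : (Real.exp (s * f j) * (w₁ (j + 1) - w₁ j)) ^ 2
      = Real.exp (2 * s * f j) * (w₁ (j + 1) - w₁ j) ^ 2 := by rw [exp_two_mul_eq_sq]; ring
  have hft := hW.abs_ft (j + 1) (by omega)
  have a2 : ((1 - e) * u (j + 1)) ^ 2 ≤ (L * K * (s * h)) ^ 2 * u (j + 1) ^ 2 := by
    refine sq_le_sq_of_abs_le_mul ?_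
    rw [abs_mul]
    refine mul_le_mul_of_nonneg_right (heb.trans ?_) (abs_nonneg _)
    nlinarith [mul_le_mul_of_nonneg_left hK (by positivity : 0 ≤ L * (s * h))]
  have a3 : ((1 - e) * (s * ft (j + 1)) * z (j + 1)) ^ 2
      ≤ (L * K * (s * h) * s) ^ 2 * z (j + 1) ^ 2 := by
    refine sq_le_sq_of_abs_le_mul ?_
    rw [abs_mul, abs_mul, abs_mul, abs_of_pos hs0]
    refine mul_le_mul_of_nonneg_right ?_ (abs_nonneg _)
    have := mul_le_mul heb (mul_le_mul_of_nonneg_left hft hs0.le) (by positivity) (by positivity)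
    linarith
  have a4 : (s * ft (j + 1) * h * dPlus h z j) ^ 2 ≤ (L * K * (s * h)) ^ 2 * dPlus h z j ^ 2 := by
    refine sq_le_sq_of_abs_le_mul ?_
    rw [abs_mul, abs_mul, abs_mul, abs_of_pos hs0, abs_of_pos hh]
    refine mul_le_mul_of_nonneg_right ?_ (abs_nonneg _)
    have h1 := mul_le_mul_of_nonneg_left hft hσ.le
    have h2 := mul_le_mul_of_nonneg_right hL1 (by positivity : 0 ≤ K * (s * h))
    linarith
  have a5 : (s * (ft (j + 1) - ft j) * z j) ^ 2 ≤ (L * K * (s * h) * s) ^ 2 * z j ^ 2 := by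
    refine sq_le_sq_of_abs_le_mul ?_
    rw [abs_mul, abs_mul, abs_of_pos hs0]
    refine mul_le_mul_of_nonneg_right ?_ (abs_nonneg _)
    have h1 := mul_le_mul_of_nonneg_left (hW.lip_ft j hj) hs0.le
    have h2 := mul_le_mul_of_nonneg_right hL1 (by positivity : 0 ≤ K * (s * h))
    have h3 := mul_le_mul_of_nonneg_left hs (by positivity : 0 ≤ L * K * (s * h))
    linarith
  have five : ∀ x1 x2 x3 x4 x5 : ℝ, (x1 + x2 - x3 + x4 + x5) ^ 2
      ≤ 5 * (x1 ^ 2 + x2 ^ 2 + x3 ^ 2 + x4 ^ 2 + x5 ^ 2) := by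
    intro x1 x2 x3 x4 x5
    nlinarith [sq_nonneg (x1 - x2), sq_nonneg (x1 + x3), sq_nonneg (x1 - x4), sq_nonneg (x1 - x5),
      sq_nonneg (x2 + x3), sq_nonneg (x2 - x4), sq_nonneg (x2 - x5), sq_nonneg (x3 + x4),
      sq_nonneg (x3 + x5), sq_nonneg (x4 - x5)]
  have := five (Real.exp (s * f j) * (w₁ (j + 1) - w₁ j)) ((1 - e) * u (j + 1))
    ((1 - e) * (s * ft (j + 1)) * z (j + 1)) (s * ft (j + 1) * h * dPlus h z j)
    (s * (ft (j + 1) - ft j) * z j)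
  rw [hsplit]
  linarith

/-- Discrete Leibniz rule: e^{sf} ∂ₕw equals ∂ₕz plus a term of size s|z|, which the s³|z|² part of
the energy pays for. -/
theorem WeightBounds.exp_mul_sq_dPlus_le (hW : WeightBounds N h s K c f ft ftt fx A b V b' B' W')
    (hK : 0 ≤ K) (hh : 0 < h) (hs : 0 < s) (hsh : s * h ≤ 1) (w : ℕ → ℝ) {j : ℕ} (hj : j ≤ N) :
    Real.exp (2 * s * f j) * dPlus h w j ^ 2
      ≤ 2 * dPlus h (conj₀ s f w) j ^ 2
        + 2 * (K * Real.exp K) ^ 2 * s ^ 2 * conj₀ s f w (j + 1) ^ 2 := by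
  set e := Real.exp (s * (f j - f (j + 1))) with he
  have hee : e * Real.exp (s * f (j + 1)) = Real.exp (s * f j) := exp_mul_sub_mul_exp ..
  have hsplit : Real.exp (s * f j) * dPlus h w j
      = dPlus h (conj₀ s f w) j + (e - 1) / h * conj₀ s f w (j + 1) := by
    simp only [conj₀, dPlus]
    field_simp
    linear_combination -w (j + 1) * hee
  have a : ((e - 1) / h * conj₀ s f w (j + 1)) ^ 2
      ≤ (K * Real.exp K * s) ^ 2 * conj₀ s f w (j + 1) ^ 2 := by
    refine sq_le_sq_of_abs_le_mul ?_
    rw [abs_mul, abs_div, abs_of_pos hh]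
    refine mul_le_mul_of_nonneg_right ?_ (abs_nonneg _)
    rw [div_le_iff₀ hh]
    have := hW.abs_exp_sub_one_le hK hs hsh hj
    linarith
  rw [exp_two_mul_eq_sq, ← mul_pow, hsplit]
  nlinarith [sq_nonneg (dPlus h (conj₀ s f w) j - (e - 1) / h * conj₀ s f w (j + 1))]

theorem WeightBounds.exp_mul_sq_deriv_le (hW : WeightBounds N h s K c f ft ftt fx A b V b' B' W')
    (w w₁ : ℕ → ℝ) {j : ℕ} (hj : j ≤ N + 1) :
    Real.exp (2 * s * f j) * w₁ j ^ 2
      ≤ 2 * conj₁ s f ft w w₁ j ^ 2 + 2 * K ^ 2 * s ^ 2 * conj₀ s f w j ^ 2 := by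
  have hsplit : Real.exp (s * f j) * w₁ j = conj₁ s f ft w w₁ j - s * (ft j * conj₀ s f w j) := by
    simp only [conj₀, conj₁]; ring
  have a : (ft j * conj₀ s f w j) ^ 2 ≤ K ^ 2 * conj₀ s f w j ^ 2 := by
    refine sq_le_sq_of_abs_le_mul ?_
    rw [abs_mul]
    exact mul_le_mul_of_nonneg_right (hW.abs_ft j hj) (abs_nonneg _)
  rw [exp_two_mul_eq_sq, ← mul_pow, hsplit]
  nlinarith [sq_nonneg (conj₁ s f ft w w₁ j + s * (ft j * conj₀ s f w j)),
    mul_le_mul_of_nonneg_left a (sq_nonneg s)]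

/-- As w vanishes at the last node, the difference quotient of z there is exactly e^{s f_N} times
that of w. Moving the weight from node N to node N + 1 costs a factor e^{2K}, since s|f_{N+1} - f_N|
≤ K. -/
theorem WeightBounds.sq_dPlus_conj₀_last_le
    (hW : WeightBounds N h s K c f ft ftt fx A b V b' B' W')
    (hK : 0 ≤ K) (hs : 0 < s) (hsh : s * h ≤ 1) {w : ℕ → ℝ} (hw : w (N + 1) = 0) :
    dPlus h (conj₀ s f w) N ^ 2
      ≤ Real.exp (2 * K) * (Real.exp (2 * s * f (N + 1)) * dPlus h w N ^ 2) := by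
  have b1 := abs_le.1 (hW.lip_f N le_rfl)
  have e1 : dPlus h (conj₀ s f w) N = Real.exp (s * f N) * dPlus h w N := by
    simp only [dPlus, conj₀, hw]; ring
  rw [e1, mul_pow, ← exp_two_mul_eq_sq, ← mul_assoc, ← Real.exp_add]
  refine mul_le_mul_of_nonneg_right (Real.exp_le_exp.2 ?_) (sq_nonneg _)
  nlinarith [mul_le_mul_of_nonneg_left b1.1 hs.le, mul_le_mul_of_nonneg_right hsh hK]

/-- Coercivity of the commutator terms on one mesh interval. -/
theorem WeightBounds.interval_lower_bound
    (hW : WeightBounds N h s K c f ft ftt fx A b V b' B' W')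
    (hK : 1 ≤ K) (hh : 0 < h) (hs : 1 ≤ s) (hsh : s * h ≤ 1)
    (hc : 5 * (K * Real.exp K) ^ 2 * K ^ 3 * (s * h) ^ 2 ≤ c)
    (w w₁ : ℕ → ℝ) {j : ℕ} (hj : j ≤ N) :
    c / 2 * (s * (conj₁ s f ft w w₁ j ^ 2 + conj₁ s f ft w w₁ (j + 1) ^ 2
          + dPlus h (conj₀ s f w) j ^ 2)
        + s ^ 3 * (conj₀ s f w j ^ 2 + conj₀ s f w (j + 1) ^ 2))
      - 2 * K * s * (Real.exp (2 * s * f j) * (w₁ (j + 1) - w₁ j) ^ 2)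
    ≤ gradForm h (s • b) (A * (s • ft)) (A * (s • b)) (s • b') (s • ftt) (s • B') j
          (conj₁ s f ft w w₁ j) (conj₁ s f ft w w₁ (j + 1)) (dPlus h (conj₀ s f w) j)
        + zeroForm h ((s ^ 2 • V) * (s • b)) (s ^ 3 • W') j (conj₀ s f w j) (conj₀ s f w (j + 1))
        - dPlus h (s • b) j * (conj₁ s f ft w w₁ (j + 1) - conj₁ s f ft w w₁ j) ^ 2 / 4
        + h ^ 2 * dPlus h ((s ^ 2 • V) * (s • b)) j * dPlus h (conj₀ s f w) j ^ 2 / 4 := by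
  have hs0 : 0 < s := by linarith
  have hK0 : 0 < K := by linarith
  have hE := hW.sq_diff_conj₁_le hK hh hs hsh w w₁ hj
  set z := conj₀ s f w
  set u := conj₁ s f ft w w₁
  set d := dPlus h z j
  have g1 : gradForm h (s • b) (A * (s • ft)) (A * (s • b)) (s • b') (s • ftt) (s • B') j
      (u j) (u (j + 1)) d
      = s * gradForm h b (A * ft) (A * b) b' ftt B' j (u j) (u (j + 1)) d := by
    simp only [gradForm, dPlus, Pi.smul_apply, Pi.mul_apply, smul_eq_mul]; ring
  have g2 : zeroForm h ((s ^ 2 • V) * (s • b)) (s ^ 3 • W') j (z j) (z (j + 1))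
      = s ^ 3 * zeroForm h (V * b) W' j (z j) (z (j + 1)) := by
    simp only [zeroForm, dPlus, Pi.smul_apply, Pi.mul_apply, smul_eq_mul]; ring
  have g3 : dPlus h (s • b) j = s * dPlus h b j := by
    simp only [dPlus, Pi.smul_apply, smul_eq_mul]; ring
  have g4 : dPlus h ((s ^ 2 • V) * (s • b)) j = s ^ 3 * dPlus h (V * b) j := by
    simp only [dPlus, Pi.smul_apply, Pi.mul_apply, smul_eq_mul]; ring
  rw [g1, g2, g3, g4]
  have k1 := mul_le_mul_of_nonneg_left (hW.grad j hj (u j) (u (j + 1)) d) hs0.le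
  have k2 := mul_le_mul_of_nonneg_left (hW.zero j hj (z j) (z (j + 1)))
    (by positivity : 0 ≤ s ^ 3)
  have k3 : s * (dPlus h b j * (u (j + 1) - u j) ^ 2) ≤ s * (K * (u (j + 1) - u j) ^ 2) :=
    mul_le_mul_of_nonneg_left (mul_le_mul_of_nonneg_right (abs_le.1 (hW.abs_diff_b j hj)).2
      (sq_nonneg _)) hs0.le
  have k4 : s * (s * h) ^ 2 * d ^ 2 * (-K) ≤ s * (s * h) ^ 2 * d ^ 2 * dPlus h (V * b) j :=
    mul_le_mul_of_nonneg_left (abs_le.1 (hW.abs_diff_Vb j hj)).1 (by positivity)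
  have k5 := mul_le_mul_of_nonneg_left hE (by positivity : 0 ≤ s * K)
  set G := u (j + 1) ^ 2 + d ^ 2 + s ^ 2 * (z j ^ 2 + z (j + 1) ^ 2) with hG
  have hG0 : 0 ≤ G := by positivity
  have k6 := mul_le_mul_of_nonneg_right hc (by positivity : 0 ≤ s * G)
  -- Since K and K e^K are at least 1, `hc` also makes the error with factor s³h² = s (sh)²
  -- absorbable.
  have hK' : K * (s * h) ^ 2 ≤ c := by
    refine le_trans ?_ hc
    refine mul_le_mul_of_nonneg_right ?_ (sq_nonneg _)
    have hL1 : 1 ≤ K * Real.exp K :=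
      one_le_mul_of_one_le_of_one_le hK (Real.one_le_exp hK0.le)
    have h1 : 1 ≤ (K * Real.exp K) ^ 2 := one_le_pow₀ hL1
    have h2 : K ≤ K ^ 3 := le_self_pow₀ hK (by norm_num)
    nlinarith [mul_le_mul h1 h2 hK0.le (by positivity)]
  have k7 := mul_le_mul_of_nonneg_right hK' (by positivity : 0 ≤ s * d ^ 2)
  have hc0 : 0 ≤ c := le_trans (by positivity) hK'
  have k8 : 0 ≤ c * s * (u j) ^ 2 := by positivity
  have k8' : 0 ≤ c * s * (u (j + 1)) ^ 2 := by positivity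
  have k9 : 0 ≤ s * K * (Real.exp (2 * s * f j) * (w₁ (j + 1) - w₁ j) ^ 2) := by positivity
  have k10 : 0 ≤ c * s ^ 3 * (z j ^ 2 + z (j + 1) ^ 2) := by positivity
  rw [hG] at k5 k6
  -- Half of c is spent: a quarter on the conjugation errors in (u_{j+1} - u_j)², a quarter on the
  -- h² term.
  linarith only [k1, k2, k3, k4, k5, k6, k7, k8, k8', k9, k10]

end Pointwise

/-! ### The Carleman inequality at a fixed time -/

section Pointwise

variable {N : ℕ} {h s K c : ℝ} {f ft ftt fx A b V b' B' W' : ℕ → ℝ}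

theorem sum_three_le_two_mul_sum {g : ℕ → ℝ} (hg : ∀ j, 0 ≤ g j) (N : ℕ) :
    ∑ j ∈ Finset.range N, (g j + g (j + 1) + g (j + 2))
      ≤ 2 * ∑ j ∈ Finset.range (N + 1), (g j + g (j + 1)) := by
  have h1 : ∑ j ∈ Finset.range N, (g j + g (j + 1))
      ≤ ∑ j ∈ Finset.range (N + 1), (g j + g (j + 1)) := by
    rw [Finset.sum_range_succ]; linarith [hg N, hg (N + 1)]
  have h2 : ∑ j ∈ Finset.range N, g (j + 2)
      ≤ ∑ j ∈ Finset.range (N + 1), (g j + g (j + 1)) := by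
    rw [Finset.sum_range_succ']
    have : ∑ j ∈ Finset.range N, g (j + 2)
        ≤ ∑ j ∈ Finset.range N, (g (j + 1) + g (j + 1 + 1)) :=
      Finset.sum_le_sum fun j _ => by linarith [hg (j + 1)]
    linarith [hg 0, hg (0 + 1)]
  rw [Finset.sum_add_distrib]
  linarith

theorem sum_range_le_sum_range_succ {g k : ℕ → ℝ} (N : ℕ) (hk : ∀ j, 0 ≤ k j)
    (h : ∀ j < N, g j ≤ k j) :
    ∑ j ∈ Finset.range N, g j ≤ ∑ j ∈ Finset.range (N + 1), k j := by
  rw [Finset.sum_range_succ]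
  have : ∑ j ∈ Finset.range N, g j ≤ ∑ j ∈ Finset.range N, k j :=
    Finset.sum_le_sum fun j hj => h j (Finset.mem_range.1 hj)
  linarith [hk N]

/-- The time derivative of the energy flux. -/
noncomputable def fluxDeriv (N : ℕ) (h s : ℝ) (f ft ftt A b V b' B' W' w w₁ w₂ : ℕ → ℝ) : ℝ :=
  ∑ j ∈ Finset.range N, fluxNodeDeriv h (conj₀ s f w) (conj₁ s f ft w w₁)
      (conj₂ s f ft ftt w w₁ w₂) (s • b) (s • ft) ((s ^ 2 • V) * (s • ft)) (s • b') (s • ftt)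
      (s ^ 3 • W') j
    + ∑ j ∈ Finset.range (N + 1), fluxIntervalDeriv h (conj₀ s f w) (conj₁ s f ft w w₁)
      (A * (s • ft)) (s • B') j

/-- The energy density of the conjugated unknown, summed over the mesh intervals. -/
noncomputable def conjEnergy (N : ℕ) (h s : ℝ) (f ft w w₁ : ℕ → ℝ) : ℝ :=
  ∑ j ∈ Finset.range (N + 1),
    (s * (conj₁ s f ft w w₁ j ^ 2 + conj₁ s f ft w w₁ (j + 1) ^ 2 + dPlus h (conj₀ s f w) j ^ 2)
      + s ^ 3 * (conj₀ s f w j ^ 2 + conj₀ s f w (j + 1) ^ 2))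

/-- The Carleman inequality in the conjugated unknown, at a fixed time and before integration of
the flux. -/
theorem WeightBounds.conjEnergy_le
    (hW : WeightBounds N h s K c f ft ftt fx A b V b' B' W')
    {m : ℝ} (hm : 0 ≤ m) (hK : 1 ≤ K) (hh : 0 < h) (hs : 1 ≤ s) (hsh : s * h ≤ 1)
    (hc : 5 * (K * Real.exp K) ^ 2 * K ^ 3 * (s * h) ^ 2 ≤ c)
    (hsc : 12 * (K * Real.exp K + m) ^ 2 ≤ c * s)
    {q w w₁ : ℕ → ℝ} (w₂ : ℕ → ℝ) (hq : ∀ j < N, |q (j + 1)| ≤ m)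
    (hw0 : w 0 = 0) (hw : w (N + 1) = 0) (hw10 : w₁ 0 = 0) (hw1 : w₁ (N + 1) = 0) :
    8 * fluxDeriv N h s f ft ftt A b V b' B' W' w w₁ w₂ + 3 * c * conjEnergy N h s f ft w w₁
      ≤ 2 * ∑ j ∈ Finset.range N, Real.exp (2 * s * f (j + 1))
            * (w₂ (j + 1) - laplacian h w (j + 1) + q (j + 1) * w (j + 1)) ^ 2
        + 16 * K * s * ∑ j ∈ Finset.range (N + 1),
            Real.exp (2 * s * f j) * (w₁ (j + 1) - w₁ j) ^ 2
        + 4 * K * Real.exp (2 * K) * s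
            * (Real.exp (2 * s * f (N + 1)) * dPlus h w N ^ 2) / h := by
  have hs0 : 0 < s := by linarith
  have hK0 : 0 < K := by linarith
  have hc0 : 0 ≤ c := le_trans (by positivity) hc
  set z := conj₀ s f w with hz
  set u := conj₁ s f ft w w₁ with hu
  have id := multiplier_identity N hh.ne' z u (conj₂ s f ft ftt w w₁ w₂) A (s • b) (s ^ 2 • V)
    (s • ft) (s • b') (s • ftt) (s • B') (s ^ 3 • W') (by simp [hz, conj₀, hw0])
    (by simp [hz, conj₀, hw]) (by simp [hu, conj₁, hw0, hw10]) (by simp [hu, conj₁, hw, hw1])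
  have up := Finset.sum_le_sum fun j hj => hW.eight_mul_product_le (w := w) (w₁ := w₁) (w₂ := w₂)
    hm hK0.le hh hs hsh (Finset.mem_range.1 hj) (hq j (Finset.mem_range.1 hj))
  rw [Finset.sum_add_distrib, ← Finset.mul_sum, ← Finset.mul_sum, ← Finset.mul_sum,
    ← Finset.mul_sum] at up
  have lo := Finset.sum_le_sum fun j (hj : j ∈ Finset.range (N + 1)) =>
    hW.interval_lower_bound hK hh hs hsh hc w w₁ (Nat.lt_succ_iff.1 (Finset.mem_range.1 hj))
  rw [Finset.sum_sub_distrib, ← Finset.mul_sum, ← Finset.mul_sum] at lo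
  have three := sum_three_le_two_mul_sum (g := fun j => z j ^ 2) (fun j => sq_nonneg _) N
  -- The contribution of x = 0 is nonnegative and is dropped; only the normal derivative at x = 1
  -- remains.
  have bd : -(K * s * Real.exp (2 * K) * (Real.exp (2 * s * f (N + 1)) * dPlus h w N ^ 2)) / (2 * h)
      ≤ (A 0 * (s • b) 0 * dPlus h z 0 ^ 2 - A (N + 1) * (s • b) (N + 1) * dPlus h z N ^ 2)
          / (2 * h) := by
    refine div_le_div_of_nonneg_right ?_ (by positivity)
    have l1 := hW.sq_dPlus_conj₀_last_le hK0.le hs0 hsh hw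
    have l2 : 0 ≤ s * (A 0 * b 0) * dPlus h z 0 ^ 2 :=
      mul_nonneg (mul_nonneg hs0.le hW.left_nonneg) (sq_nonneg _)
    have l3 := mul_le_mul_of_nonneg_right hW.right_le
      (by positivity : 0 ≤ s * dPlus h z N ^ 2)
    have l4 := mul_le_mul_of_nonneg_left l1 (by positivity : 0 ≤ K * s)
    simp only [Pi.smul_apply, smul_eq_mul]
    linarith
  have zE : s ^ 3 * ∑ j ∈ Finset.range (N + 1), (z j ^ 2 + z (j + 1) ^ 2)
      ≤ conjEnergy N h s f ft w w₁ := by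
    rw [conjEnergy, Finset.mul_sum]
    refine Finset.sum_le_sum fun j _ => ?_
    have : 0 ≤ s * (conj₁ s f ft w w₁ j ^ 2 + conj₁ s f ft w w₁ (j + 1) ^ 2
      + dPlus h (conj₀ s f w) j ^ 2) := by positivity
    linarith
  -- The remainder R, potential included, contributes s²|z|². For s large by `hsc` it takes one of
  -- the four units of c times the energy, leaving the factor 3c.
  have lower : 12 * (K * Real.exp K + m) ^ 2 * s ^ 2
      * ∑ j ∈ Finset.range (N + 1), (z j ^ 2 + z (j + 1) ^ 2)
      ≤ c * conjEnergy N h s f ft w w₁ := by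
    refine le_trans ?_ (mul_le_mul_of_nonneg_left zE hc0)
    have := mul_le_mul_of_nonneg_right hsc (by positivity :
      0 ≤ s ^ 2 * ∑ j ∈ Finset.range (N + 1), (z j ^ 2 + z (j + 1) ^ 2))
    linarith
  have three' := mul_le_mul_of_nonneg_left three
    (by positivity : 0 ≤ 6 * ((K * Real.exp K + m) * s) ^ 2)
  simp only [Pi.smul_apply, smul_eq_mul] at id bd
  rw [id] at up
  have hbd : -(K * s * Real.exp (2 * K) * (Real.exp (2 * s * f (N + 1)) * dPlus h w N ^ 2)) / (2 * h)
      = -(4 * K * Real.exp (2 * K) * s * (Real.exp (2 * s * f (N + 1)) * dPlus h w N ^ 2) / h) / 8 := by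
    ring
  rw [hbd] at bd
  simp only [fluxDeriv]
  change c / 2 * conjEnergy N h s f ft w w₁ - _ ≤ _ at lo
  linarith

theorem WeightBounds.weighted_sums_le (hW : WeightBounds N h s K c f ft ftt fx A b V b' B' W')
    (hK : 0 ≤ K) (hh : 0 < h) (hs : 0 < s) (hsh : s * h ≤ 1) (w w₁ : ℕ → ℝ) :
    s * ∑ j ∈ Finset.range N, Real.exp (2 * s * f (j + 1)) * w₁ (j + 1) ^ 2
        + s * ∑ j ∈ Finset.range (N + 1), Real.exp (2 * s * f j) * dPlus h w j ^ 2
        + s ^ 3 * ∑ j ∈ Finset.range N, Real.exp (2 * s * f (j + 1)) * w (j + 1) ^ 2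
      ≤ (2 * K ^ 2 + 2 * (K * Real.exp K) ^ 2 + 2) * conjEnergy N h s f ft w w₁ := by
  have h1 := sum_range_le_sum_range_succ (g := fun j => Real.exp (2 * s * f (j + 1)) * w₁ (j + 1) ^ 2)
    (k := fun j => 2 * conj₁ s f ft w w₁ (j + 1) ^ 2 + 2 * K ^ 2 * s ^ 2 * conj₀ s f w (j + 1) ^ 2)
    N (fun j => by positivity) (fun j hj => hW.exp_mul_sq_deriv_le w w₁ (by omega))
  have h2 := Finset.sum_le_sum fun j (hj : j ∈ Finset.range (N + 1)) =>
    hW.exp_mul_sq_dPlus_le hK hh hs hsh w (Nat.lt_succ_iff.1 (Finset.mem_range.1 hj))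
  have h3 := sum_range_le_sum_range_succ (g := fun j => Real.exp (2 * s * f (j + 1)) * w (j + 1) ^ 2)
    (k := fun j => conj₀ s f w (j + 1) ^ 2)
    N (fun j => by positivity) (fun j hj => by rw [exp_two_mul_eq_sq, conj₀, mul_pow])
  have h4 := add_le_add (add_le_add (mul_le_mul_of_nonneg_left h1 hs.le)
    (mul_le_mul_of_nonneg_left h2 hs.le)) (mul_le_mul_of_nonneg_left h3 (pow_pos hs 3).le)
  refine h4.trans ?_
  rw [conjEnergy, Finset.mul_sum, Finset.mul_sum, Finset.mul_sum, Finset.mul_sum,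
    ← Finset.sum_add_distrib, ← Finset.sum_add_distrib]
  refine Finset.sum_le_sum fun j _ => ?_
  generalize conj₁ s f ft w w₁ (j + 1) = a
  generalize conj₁ s f ft w w₁ j = a'
  generalize conj₀ s f w (j + 1) = e
  generalize conj₀ s f w j = e'
  generalize dPlus h (conj₀ s f w) j = d
  set L := K * Real.exp K
  have p1 : 0 ≤ (2 * K ^ 2 + 2 * L ^ 2 + 2) * (s * a' ^ 2) := by positivity
  have p2 : 0 ≤ (2 * K ^ 2 + 2 * L ^ 2) * (s * (a ^ 2 + d ^ 2)) := by positivity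
  have p3 : 0 ≤ (2 * K ^ 2 + 2 * L ^ 2 + 2) * (s ^ 3 * e' ^ 2) := by positivity
  have p4 : 0 ≤ s ^ 3 * e ^ 2 := by positivity
  linarith

/-- The Carleman inequality at a fixed time, before integration of the flux. -/
theorem exists_pointwise_carleman {K c m : ℝ} (hK : 1 ≤ K) (hc : 0 < c) (hm : 0 ≤ m) :
    ∃ s₀ η κ M : ℝ, 0 < s₀ ∧ 0 < η ∧ 0 < κ ∧ 0 < M ∧
      ∀ (N : ℕ) (h s : ℝ) (f ft ftt fx A b V b' B' W' : ℕ → ℝ), 0 < h → s₀ ≤ s → s * h ≤ η →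
      WeightBounds N h s K c f ft ftt fx A b V b' B' W' →
      ∀ q w w₁ w₂ : ℕ → ℝ, (∀ j < N, |q (j + 1)| ≤ m) →
        w 0 = 0 → w (N + 1) = 0 → w₁ 0 = 0 → w₁ (N + 1) = 0 →
        s * ∑ j ∈ Finset.range N, Real.exp (2 * s * f (j + 1)) * w₁ (j + 1) ^ 2
          + s * ∑ j ∈ Finset.range (N + 1), Real.exp (2 * s * f j) * dPlus h w j ^ 2
          + s ^ 3 * ∑ j ∈ Finset.range N, Real.exp (2 * s * f (j + 1)) * w (j + 1) ^ 2
          + κ * fluxDeriv N h s f ft ftt A b V b' B' W' w w₁ w₂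
        ≤ M * ∑ j ∈ Finset.range N, Real.exp (2 * s * f (j + 1))
              * (w₂ (j + 1) - laplacian h w (j + 1) + q (j + 1) * w (j + 1)) ^ 2
          + M * s * (Real.exp (2 * s * f (N + 1)) * dPlus h w N ^ 2) / h
          + M * s * ∑ j ∈ Finset.range (N + 1),
              Real.exp (2 * s * f j) * (w₁ (j + 1) - w₁ j) ^ 2 := by
  have hK0 : 0 < K := by linarith
  set L := K * Real.exp K with hL
  have hL0 : 0 < L := by positivity
  set P := 5 * L ^ 2 * K ^ 3 with hP
  have hP0 : 0 < P := by positivity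
  set C := (2 * K ^ 2 + 2 * L ^ 2 + 2) / (3 * c) with hC
  have hC0 : 0 < C := by positivity
  -- The lower bound on s gives 12(L + m)² ≤ c s, and the bound on sh gives P (sh)² ≤ c. The factor
  -- C is the cost of returning from z to w, divided by the 3c gained; κ is the 8 of 8PQ times C,
  -- and the last constant adds up the three right-hand coefficients.
  refine ⟨1 + 12 * (L + m) ^ 2 / c, min 1 (c / P), 8 * C,
    C * (2 + 16 * K + 4 * K * Real.exp (2 * K)), by positivity, by positivity, by positivity,
    by positivity, ?_⟩
  intro N h s f ft ftt fx A b V b' B' W' hh hs hsh hW q w w₁ w₂ hq hw0 hw hw10 hw1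
  have hs1 : 1 ≤ s := le_trans (le_add_of_nonneg_right (by positivity)) hs
  have hs0 : 0 < s := by linarith
  have hσ0 : 0 < s * h := by positivity
  have hσ1 : s * h ≤ 1 := hsh.trans (min_le_left _ _)
  have hσ2 : s * h ≤ c / P := hsh.trans (min_le_right _ _)
  have k1 : P * (s * h) ^ 2 ≤ c := by
    rw [le_div_iff₀ hP0] at hσ2
    nlinarith [mul_le_mul_of_nonneg_left hσ1 (by positivity : 0 ≤ P * (s * h))]
  have k2 : 12 * (L + m) ^ 2 ≤ c * s := by
    have : 12 * (L + m) ^ 2 / c ≤ s := by linarith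
    rw [div_le_iff₀ hc] at this
    linarith
  have e1 := hW.conjEnergy_le hm hK hh hs1 hσ1 k1 k2 w₂ hq hw0 hw hw10 hw1
  have e2 := hW.weighted_sums_le hK0.le hh hs0 hσ1 w w₁
  have hCc : C * (3 * c) = 2 * K ^ 2 + 2 * L ^ 2 + 2 := div_mul_cancel₀ _ (by positivity)
  rw [← hL, ← hCc] at e2
  have e3 := mul_le_mul_of_nonneg_left e1 hC0.le
  have q1 : 0 ≤ ∑ j ∈ Finset.range N, Real.exp (2 * s * f (j + 1))
      * (w₂ (j + 1) - laplacian h w (j + 1) + q (j + 1) * w (j + 1)) ^ 2 :=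
    Finset.sum_nonneg fun j _ => by positivity
  have q2 : 0 ≤ ∑ j ∈ Finset.range (N + 1), Real.exp (2 * s * f j) * (w₁ (j + 1) - w₁ j) ^ 2 :=
    Finset.sum_nonneg fun j _ => by positivity
  have q3 : 0 ≤ (Real.exp (2 * s * f (N + 1)) * dPlus h w N ^ 2) / h := by positivity
  rw [mul_div_assoc] at e3 ⊢
  generalize (Real.exp (2 * s * f (N + 1)) * dPlus h w N ^ 2) / h = Y at *
  generalize ∑ j ∈ Finset.range (N + 1), Real.exp (2 * s * f j) * (w₁ (j + 1) - w₁ j) ^ 2 = X at *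
  generalize ∑ j ∈ Finset.range N, Real.exp (2 * s * f (j + 1))
      * (w₂ (j + 1) - laplacian h w (j + 1) + q (j + 1) * w (j + 1)) ^ 2 = F at *
  have r1 : 0 ≤ C * (16 * K + 4 * K * Real.exp (2 * K)) * F := by positivity
  have r2 : 0 ≤ C * (2 + 4 * K * Real.exp (2 * K)) * (s * X) := by positivity
  have r3 : 0 ≤ C * (2 + 16 * K) * (s * Y) := by positivity
  linarith

end Pointwise

/-! ### The function `sinh y / y` -/

/-- The entire function `sinh y / y`. -/
noncomputable def sinhc : ℝ → ℝ := dslope Real.sinh 0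

theorem mul_sinhc (y : ℝ) : y * sinhc y = Real.sinh y := by
  simpa [sinhc] using sub_smul_dslope Real.sinh 0 y

theorem sinhc_zero : sinhc 0 = 1 := by
  simp [sinhc, dslope_same]

/-- Smoothness at 0 is the point: it lets the coefficients of the conjugated operator extend to σ =
0. There a power series of sinh gives one for its `dslope`; elsewhere the function is a quotient of
analytic functions. -/
theorem contDiff_sinhc {n : WithTop ℕ∞} : ContDiff ℝ n sinhc := by
  rw [contDiff_iff_contDiffAt]
  intro y
  refine AnalyticAt.contDiffAt ?_
  by_cases hy : y = 0
  · subst hy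
    obtain ⟨p, hp⟩ := (Real.analyticAt_sinh : AnalyticAt ℝ Real.sinh 0)
    exact ⟨_, hp.has_fpower_series_dslope_fslope⟩
  · have h1 : AnalyticAt ℝ (fun y : ℝ => Real.sinh y / y) y :=
      Real.analyticAt_sinh.div analyticAt_id hy
    refine h1.congr ?_
    filter_upwards [isOpen_ne.mem_nhds hy] with x hx
    rw [← mul_sinhc, mul_div_cancel_left₀ _ hx]

/-- Half-angle formula. It presents 2(cosh y - 1)/σ², with y = σφₓ, as a square that is smooth at σ
= 0. -/
theorem mul_sinhc_half_sq (y : ℝ) : (y * sinhc (y / 2)) ^ 2 = 2 * (Real.cosh y - 1) := by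
  have h1 := mul_sinhc (y / 2)
  have h2 := Real.cosh_two_mul (y / 2)
  have h3 := Real.cosh_sq (y / 2)
  rw [mul_div_cancel₀ y (two_ne_zero' ℝ)] at h2
  have h4 : y * sinhc (y / 2) = 2 * Real.sinh (y / 2) := by rw [← h1]; ring
  rw [h4, h2, h3]; ring

/-! ### Uniform estimates for functions of `(σ, t, x)` near `σ = 0` -/

/-- The partial derivative in the second variable of a function of `(σ, t, x)`. -/
noncomputable def partialT (F : ℝ × ℝ × ℝ → ℝ) (p : ℝ × ℝ × ℝ) : ℝ := fderiv ℝ F p (0, 1, 0)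

/-- The partial derivative in the third variable of a function of `(σ, t, x)`. -/
noncomputable def partialX (F : ℝ × ℝ × ℝ → ℝ) (p : ℝ × ℝ × ℝ) : ℝ := fderiv ℝ F p (0, 0, 1)

section Uniform

variable {F : ℝ × ℝ × ℝ → ℝ}

theorem continuous_partialT (hF : ContDiff ℝ 1 F) : Continuous (partialT F) :=
  (hF.continuous_fderiv one_ne_zero).clm_apply continuous_const

theorem continuous_partialX (hF : ContDiff ℝ 1 F) : Continuous (partialX F) :=
  (hF.continuous_fderiv one_ne_zero).clm_apply continuous_const

theorem hasDerivAt_partialT (hF : ContDiff ℝ 1 F) (σ t x : ℝ) :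
    HasDerivAt (fun t => F (σ, t, x)) (partialT F (σ, t, x)) t := by
  have h1 := (hF.differentiable one_ne_zero (σ, t, x)).hasFDerivAt
  have h2 : HasDerivAt (fun t : ℝ => (σ, t, x)) ((0, 1, 0) : ℝ × ℝ × ℝ) t :=
    (hasDerivAt_const t σ).prodMk ((hasDerivAt_id t).prodMk (hasDerivAt_const t x))
  exact h1.comp_hasDerivAt t h2

theorem hasDerivAt_partialX (hF : ContDiff ℝ 1 F) (σ t x : ℝ) :
    HasDerivAt (fun x => F (σ, t, x)) (partialX F (σ, t, x)) x := by
  have h1 := (hF.differentiable one_ne_zero (σ, t, x)).hasFDerivAt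
  have h2 : HasDerivAt (fun x : ℝ => (σ, t, x)) ((0, 0, 1) : ℝ × ℝ × ℝ) x :=
    (hasDerivAt_const x σ).prodMk ((hasDerivAt_const x t).prodMk (hasDerivAt_id x))
  exact h1.comp_hasDerivAt x h2

/-- Uniform continuity on the compact set [0,1] × [-T,T] × [0,1]. The variable σ = sh is kept
independent of h, so the comparison is with σ = 0 and uniform in s. -/
theorem exists_abs_sub_le (hF : Continuous F) (T : ℝ) {δ : ℝ} (hδ : 0 < δ) :
    ∃ η > 0, ∀ σ ∈ Icc 0 η, ∀ t ∈ Icc (-T) T, ∀ x ∈ Icc (0 : ℝ) 1, ∀ y ∈ Icc (0 : ℝ) 1,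
      |y - x| ≤ η → |F (σ, t, y) - F (0, t, x)| ≤ δ := by
  have hc : IsCompact (Icc (0 : ℝ) 1 ×ˢ Icc (-T) T ×ˢ Icc (0 : ℝ) 1) :=
    isCompact_Icc.prod (isCompact_Icc.prod isCompact_Icc)
  obtain ⟨η, hη, H⟩ := Metric.uniformContinuousOn_iff.1
    (hc.uniformContinuousOn_of_continuous hF.continuousOn) δ hδ
  refine ⟨min 1 (η / 2), by positivity, fun σ hσ t ht x hx y hy hxy => ?_⟩
  have h1 : η / 2 < η := by linarith
  refine (H (σ, t, y) ⟨⟨hσ.1, hσ.2.trans (min_le_left _ _)⟩, ht, hy⟩ (0, t, x)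
    ⟨⟨le_rfl, zero_le_one⟩, ht, hx⟩ ?_).le
  simp only [Prod.dist_eq, dist_self, Real.dist_eq, sub_zero]
  refine max_lt ?_ (max_lt hη ?_)
  · rw [abs_of_nonneg hσ.1]; exact (hσ.2.trans (min_le_right _ _)).trans_lt h1
  · exact (hxy.trans (min_le_right _ _)).trans_lt h1

theorem exists_abs_le (hF : Continuous F) (T : ℝ) :
    ∃ K : ℝ, ∀ σ ∈ Icc (0 : ℝ) 1, ∀ t ∈ Icc (-T) T, ∀ x ∈ Icc (0 : ℝ) 1, |F (σ, t, x)| ≤ K := by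
  have hc : IsCompact (Icc (0 : ℝ) 1 ×ˢ Icc (-T) T ×ˢ Icc (0 : ℝ) 1) :=
    isCompact_Icc.prod (isCompact_Icc.prod isCompact_Icc)
  obtain ⟨K, hK⟩ := hc.exists_bound_of_continuousOn hF.continuousOn
  exact ⟨K, fun σ hσ t ht x hx => hK (σ, t, x) ⟨hσ, ht, hx⟩⟩

theorem exists_slope_eq_partialX (hF : ContDiff ℝ 1 F) (σ t : ℝ) {x h : ℝ} (hh : 0 < h) :
    ∃ ξ ∈ Ioo x (x + h), (F (σ, t, x + h) - F (σ, t, x)) / h = partialX F (σ, t, ξ) := by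
  obtain ⟨ξ, hξ, e⟩ := exists_hasDerivAt_eq_slope (fun x => F (σ, t, x))
    (fun x => partialX F (σ, t, x)) (lt_add_of_pos_right x hh)
    (fun y _ => (hasDerivAt_partialX hF σ t y).continuousAt.continuousWithinAt)
    (fun y _ => hasDerivAt_partialX hF σ t y)
  exact ⟨ξ, hξ, by rw [e]; simp⟩

/-- By the mean value theorem the difference quotient is an x-derivative at an intermediate point,
so uniform continuity of that derivative applies. -/
theorem exists_abs_slope_sub_le (hF : ContDiff ℝ 1 F) (T : ℝ) {δ : ℝ} (hδ : 0 < δ) :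
    ∃ η > 0, ∀ σ ∈ Icc 0 η, ∀ t ∈ Icc (-T) T, ∀ x h : ℝ, 0 ≤ x → 0 < h → x + h ≤ 1 → h ≤ η →
      |(F (σ, t, x + h) - F (σ, t, x)) / h - partialX F (0, t, x)| ≤ δ := by
  obtain ⟨η, hη, H⟩ := exists_abs_sub_le (continuous_partialX hF) T hδ
  refine ⟨η, hη, fun σ hσ t ht x h hx hh hxh hhη => ?_⟩
  obtain ⟨ξ, hξ, e⟩ := exists_slope_eq_partialX hF σ t (x := x) hh
  rw [e]
  refine H σ hσ t ht x ⟨hx, by linarith⟩ ξ ⟨by linarith [hξ.1], by linarith [hξ.2]⟩ ?_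
  rw [abs_of_pos (by linarith [hξ.1])]
  linarith [hξ.2]

theorem exists_abs_slope_le (hF : ContDiff ℝ 1 F) (T : ℝ) :
    ∃ K : ℝ, ∀ σ ∈ Icc (0 : ℝ) 1, ∀ t ∈ Icc (-T) T, ∀ x h : ℝ, 0 ≤ x → 0 < h → x + h ≤ 1 →
      |(F (σ, t, x + h) - F (σ, t, x)) / h| ≤ K := by
  obtain ⟨K, H⟩ := exists_abs_le (continuous_partialX hF) T
  refine ⟨K, fun σ hσ t ht x h hx hh hxh => ?_⟩
  obtain ⟨ξ, hξ, e⟩ := exists_slope_eq_partialX hF σ t (x := x) hh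
  rw [e]
  exact H σ hσ t ht ξ ⟨by linarith [hξ.1], by linarith [hξ.2]⟩

/-- First order Taylor estimates in `x`, around both endpoints of a mesh interval. -/
theorem exists_taylor_le {G : ℝ × ℝ × ℝ → ℝ} (hF : ContDiff ℝ 1 F) (hG : ContDiff ℝ 1 G)
    (hFG : ∀ p, partialX F p = G p) (T : ℝ) :
    ∃ K : ℝ, ∀ σ ∈ Icc (0 : ℝ) 1, ∀ t ∈ Icc (-T) T, ∀ x h : ℝ, 0 ≤ x → 0 < h → x + h ≤ 1 →
      |F (σ, t, x + h) - F (σ, t, x) - h * G (σ, t, x)| ≤ K * h ^ 2 ∧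
      |F (σ, t, x + h) - F (σ, t, x) - h * G (σ, t, x + h)| ≤ K * h ^ 2 := by
  obtain ⟨K, H⟩ := exists_abs_slope_le hG T
  refine ⟨K, fun σ hσ t ht x h hx hh hxh => ?_⟩
  obtain ⟨ξ, hξ, e⟩ := exists_slope_eq_partialX hF σ t (x := x) hh
  have lip : ∀ y y' : ℝ, 0 ≤ y → y < y' → y' ≤ 1 → |G (σ, t, y') - G (σ, t, y)| ≤ K * (y' - y) := by
    intro y y' h0 h1 h2
    have := H σ hσ t ht y (y' - y) h0 (by linarith) (by linarith)
    rwa [add_sub_cancel, abs_div, abs_of_pos (sub_pos.2 h1), div_le_iff₀ (sub_pos.2 h1)] at this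
  have hK : 0 ≤ K := (abs_nonneg _).trans (H σ hσ t ht x h hx hh hxh)
  have e' : F (σ, t, x + h) - F (σ, t, x) = h * G (σ, t, ξ) := by
    rw [← hFG, ← e]; field_simp
  rw [e', ← mul_sub, ← mul_sub, abs_mul, abs_mul, abs_of_pos hh]
  have l1 := lip x ξ hx hξ.1 (by linarith [hξ.2])
  have l2 := lip ξ (x + h) (by linarith [hξ.1]) hξ.2 hxh
  rw [abs_sub_comm] at l2
  have m1 : K * (ξ - x) ≤ K * h := mul_le_mul_of_nonneg_left (by linarith [hξ.2]) hK
  have m2 : K * (x + h - ξ) ≤ K * h := mul_le_mul_of_nonneg_left (by linarith [hξ.1]) hK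
  constructor
  · nlinarith [mul_le_mul_of_nonneg_left (l1.trans m1) hh.le]
  · nlinarith [mul_le_mul_of_nonneg_left (l2.trans m2) hh.le]

end Uniform

/-! ### Positivity of the quadratic forms under perturbation -/

/-- With the coefficients replaced by their limits, the form is one quarter of the sum of the
continuous form at (α, d) and at (α', d). Its coercivity constant c/4 drops to c/8 after
perturbations of size δ ≤ c/32. -/
theorem gradForm_lower_bound {h δ c ptt ptx pxx : ℝ} {b B G b' τ' B' : ℕ → ℝ} {j : ℕ}
    (hpos : ∀ a d : ℝ, c * (a ^ 2 + d ^ 2)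
      ≤ (ptt + pxx) * a ^ 2 - 4 * ptx * a * d + (ptt + pxx) * d ^ 2)
    (hδ : 32 * δ ≤ c) (hδ0 : 0 ≤ δ)
    (h1 : |τ' j - ptt| ≤ δ) (h2 : |τ' (j + 1) - ptt| ≤ δ) (h3 : |dPlus h b j - pxx| ≤ δ)
    (h4 : |b' j - ptx| ≤ δ) (h5 : |b' (j + 1) - ptx| ≤ δ) (h6 : |dPlus h B j - ptx| ≤ δ)
    (h7 : |B' j - ptt| ≤ δ) (h8 : |B' (j + 1) - ptt| ≤ δ) (h9 : |dPlus h G j - pxx| ≤ δ)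
    (α α' d : ℝ) :
    c / 8 * (α ^ 2 + α' ^ 2 + d ^ 2) ≤ gradForm h b B G b' τ' B' j α α' d := by
  have sq : ∀ e r a : ℝ, |e - r| ≤ δ → -(δ * a ^ 2) ≤ (e - r) * a ^ 2 := fun e r a he => by
    nlinarith [mul_le_mul_of_nonneg_right (abs_le.1 he).1 (sq_nonneg a)]
  have cross : ∀ e r a d : ℝ, |e - r| ≤ δ → (e - r) * (a * d) ≤ δ * (a ^ 2 + d ^ 2) / 2 := by
    intro e r a d he
    have : |a * d| ≤ (a ^ 2 + d ^ 2) / 2 := by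
      rw [abs_mul, ← sq_abs a, ← sq_abs d]; nlinarith [sq_nonneg (|a| - |d|)]
    calc (e - r) * (a * d) ≤ |(e - r) * (a * d)| := le_abs_self _
      _ = |e - r| * |a * d| := abs_mul _ _
      _ ≤ δ * ((a ^ 2 + d ^ 2) / 2) := mul_le_mul he this (abs_nonneg _) hδ0
      _ = _ := by ring
  have i1 := sq _ _ α h1
  have i2 := sq _ _ α' h2
  have i3 := sq _ _ α h3
  have i3' := sq _ _ α' h3
  have i4 := cross _ _ α d h4
  have i5 := cross _ _ α' d h5
  have i6 := cross _ _ α d h6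
  have i6' := cross _ _ α' d h6
  have i7 := sq _ _ d h7
  have i8 := sq _ _ d h8
  have i9 := sq _ _ d h9
  have p1 := hpos α d
  have p2 := hpos α' d
  have s1 := mul_le_mul_of_nonneg_right hδ (by positivity : 0 ≤ α ^ 2 + α' ^ 2 + 2 * d ^ 2)
  have s2 : 0 ≤ c * (α ^ 2 + α' ^ 2 + 2 * d ^ 2) :=
    mul_nonneg (by linarith) (by positivity)
  have s3 : 0 ≤ c * d ^ 2 := mul_nonneg (by linarith) (by positivity)
  have s4 : 0 ≤ δ * α ^ 2 := by positivity
  have s5 : 0 ≤ δ * α' ^ 2 := by positivity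
  have s6 : 0 ≤ δ * d ^ 2 := by positivity
  unfold gradForm
  linarith

theorem zeroForm_lower_bound {h δ c pw px : ℝ} {H W' : ℕ → ℝ} {j : ℕ} (hpos : c ≤ pw - px)
    (hδ : 32 * δ ≤ c) (hδ0 : 0 ≤ δ) (h1 : |W' j - pw| ≤ δ) (h2 : |W' (j + 1) - pw| ≤ δ)
    (h3 : |dPlus h H j - px| ≤ δ) (ζ ζ' : ℝ) :
    c / 8 * (ζ ^ 2 + ζ' ^ 2) ≤ zeroForm h H W' j ζ ζ' := by
  have b1 := (abs_le.1 h1).1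
  have b2 := (abs_le.1 h2).1
  have b3 := (abs_le.1 h3).2
  have k1 : 0 ≤ (W' j - dPlus h H j - c / 2) * ζ ^ 2 := mul_nonneg (by linarith) (sq_nonneg _)
  have k2 : 0 ≤ (W' (j + 1) - dPlus h H j - c / 2) * ζ' ^ 2 :=
    mul_nonneg (by linarith) (sq_nonneg _)
  unfold zeroForm
  linarith

/-! ### The weight `φ` and its derivatives -/

section Weight

variable (x0 β C0 lam : ℝ)

/-- `∂ₜφ`. -/
noncomputable def phiT (t x : ℝ) : ℝ := lam * (-2 * β * t) * phi x0 β C0 lam t x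

/-- `∂ₓφ`. -/
noncomputable def phiX (t x : ℝ) : ℝ := lam * (2 * (x - x0)) * phi x0 β C0 lam t x

/-- `∂ₜₜφ`. -/
noncomputable def phiTT (t x : ℝ) : ℝ :=
  (lam * (-2 * β) + (lam * (-2 * β * t)) ^ 2) * phi x0 β C0 lam t x

/-- `∂ₜₓφ`. -/
noncomputable def phiTX (t x : ℝ) : ℝ :=
  lam * (-2 * β * t) * (lam * (2 * (x - x0))) * phi x0 β C0 lam t x

/-- `∂ₓₓφ`. -/
noncomputable def phiXX (t x : ℝ) : ℝ :=
  (lam * 2 + (lam * (2 * (x - x0))) ^ 2) * phi x0 β C0 lam t x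

variable (t x : ℝ)

theorem phi_eq : phi x0 β C0 lam t x = Real.exp (lam * ((x - x0) ^ 2 - β * t ^ 2 + C0)) := by
  rw [phi, psi, sq_abs]

theorem hasDerivAt_phi_t :
    HasDerivAt (fun t => phi x0 β C0 lam t x) (phiT x0 β C0 lam t x) t := by
  simp only [phiT, phi_eq]
  have := (((((hasDerivAt_pow 2 t).const_mul β).const_sub ((x - x0) ^ 2)).add_const C0).const_mul
    lam).exp
  refine this.congr_deriv ?_
  push_cast; ring

theorem hasDerivAt_phi_x :
    HasDerivAt (fun x => phi x0 β C0 lam t x) (phiX x0 β C0 lam t x) x := by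
  simp only [phiX, phi_eq]
  have := ((((((hasDerivAt_id x).sub_const x0).pow 2).sub_const (β * t ^ 2)).add_const
    C0).const_mul lam).exp
  refine this.congr_deriv ?_
  simp only [Pi.pow_apply, id]; push_cast; ring

theorem hasDerivAt_phiT_t :
    HasDerivAt (fun t => phiT x0 β C0 lam t x) (phiTT x0 β C0 lam t x) t := by
  have := (((hasDerivAt_id t).const_mul (-2 * β)).const_mul lam).mul
    (hasDerivAt_phi_t x0 β C0 lam t x)
  refine HasDerivAt.congr_deriv this ?_
  simp only [phiTT, phiT, id]; ring

theorem hasDerivAt_phiT_x :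
    HasDerivAt (fun x => phiT x0 β C0 lam t x) (phiTX x0 β C0 lam t x) x := by
  have := (hasDerivAt_phi_x x0 β C0 lam t x).const_mul (lam * (-2 * β * t))
  refine HasDerivAt.congr_deriv this ?_
  simp only [phiTX, phiX]; ring

theorem hasDerivAt_phiX_t :
    HasDerivAt (fun t => phiX x0 β C0 lam t x) (phiTX x0 β C0 lam t x) t := by
  have := (hasDerivAt_phi_t x0 β C0 lam t x).const_mul (lam * (2 * (x - x0)))
  refine HasDerivAt.congr_deriv this ?_
  simp only [phiTX, phiT]; ring

theorem hasDerivAt_phiX_x :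
    HasDerivAt (fun x => phiX x0 β C0 lam t x) (phiXX x0 β C0 lam t x) x := by
  have := ((((hasDerivAt_id x).sub_const x0).const_mul 2).const_mul lam).mul
    (hasDerivAt_phi_x x0 β C0 lam t x)
  refine HasDerivAt.congr_deriv this ?_
  simp only [phiXX, phiX, id]; ring

/-- Pseudoconvexity of the weight, for the gradient terms. -/
theorem gradient_pseudoconvex (hβ : β ≤ 1) (hlam : 0 ≤ lam) (hphi : 1 ≤ phi x0 β C0 lam t x)
    (a d : ℝ) :
    2 * (1 - β) * lam * (a ^ 2 + d ^ 2)
      ≤ (phiTT x0 β C0 lam t x + phiXX x0 β C0 lam t x) * a ^ 2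
        - 4 * phiTX x0 β C0 lam t x * a * d
        + (phiTT x0 β C0 lam t x + phiXX x0 β C0 lam t x) * d ^ 2 := by
  have h1 : 0 ≤ 2 * (1 - β) * lam * (a ^ 2 + d ^ 2) * (phi x0 β C0 lam t x - 1) := by
    have := sub_nonneg.2 hβ
    have := sub_nonneg.2 hphi
    positivity
  -- The λ² part of the form is a sum of two squares in ψₜ and ψₓ, so coercivity comes from the λ
  -- part, where ψₜₜ + ψₓₓ = 2(1 - β) > 0 when β < 1.
  have h2 : 0 ≤ phi x0 β C0 lam t x * lam ^ 2
      * ((-2 * β * t * a - 2 * (x - x0) * d) ^ 2 + (2 * (x - x0) * a - -2 * β * t * d) ^ 2) := by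
    positivity
  simp only [phiTT, phiXX, phiTX]
  linarith

/-- `∂ₜ((φₜ² - φₓ²) φₜ)`. -/
noncomputable def potT (t x : ℝ) : ℝ :=
  (2 * phiT x0 β C0 lam t x * phiTT x0 β C0 lam t x
      - 2 * phiX x0 β C0 lam t x * phiTX x0 β C0 lam t x) * phiT x0 β C0 lam t x
    + (phiT x0 β C0 lam t x ^ 2 - phiX x0 β C0 lam t x ^ 2) * phiTT x0 β C0 lam t x

/-- `∂ₓ((φₜ² - φₓ²) φₓ)`. -/
noncomputable def potX (t x : ℝ) : ℝ :=
  (2 * phiT x0 β C0 lam t x * phiTX x0 β C0 lam t x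
      - 2 * phiX x0 β C0 lam t x * phiXX x0 β C0 lam t x) * phiX x0 β C0 lam t x
    + (phiT x0 β C0 lam t x ^ 2 - phiX x0 β C0 lam t x ^ 2) * phiXX x0 β C0 lam t x

theorem hasDerivAt_potT : HasDerivAt (fun t => (phiT x0 β C0 lam t x ^ 2 - phiX x0 β C0 lam t x ^ 2)
    * phiT x0 β C0 lam t x) (potT x0 β C0 lam t x) t := by
  have hT := hasDerivAt_phiT_t x0 β C0 lam t x
  have := ((hT.pow 2).sub ((hasDerivAt_phiX_t x0 β C0 lam t x).pow 2)).mul hT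
  refine HasDerivAt.congr_deriv this ?_
  simp [potT]

theorem hasDerivAt_potX : HasDerivAt (fun x => (phiT x0 β C0 lam t x ^ 2 - phiX x0 β C0 lam t x ^ 2)
    * phiX x0 β C0 lam t x) (potX x0 β C0 lam t x) x := by
  have hX := hasDerivAt_phiX_x x0 β C0 lam t x
  have := (((hasDerivAt_phiT_x x0 β C0 lam t x).pow 2).sub (hX.pow 2)).mul hX
  refine HasDerivAt.congr_deriv this ?_
  simp [potX]

/-- Pseudoconvexity of the weight, for the zeroth order terms. -/
theorem potential_pseudoconvex (hβ0 : 0 ≤ β) (hβ : β ≤ 1) (hx0 : x0 ≤ 0) (hx : 0 ≤ x)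
    (hlam0 : 0 ≤ lam) (hlam : 1 ≤ lam * ((1 - β) * x0 ^ 2)) (hphi : 1 ≤ phi x0 β C0 lam t x) :
    8 * (1 - β) * x0 ^ 2 * lam ^ 3 ≤ potT x0 β C0 lam t x - potX x0 β C0 lam t x := by
  set P := -2 * β * t with hP
  set R := 2 * (x - x0) with hR
  set y := phi x0 β C0 lam t x with hy
  -- With P = ψₜ and R = ψₓ, everything reduces to a quadratic polynomial in P² - R² with leading
  -- coefficient 3λ.
  have e1 : potT x0 β C0 lam t x - potX x0 β C0 lam t x
      = lam ^ 3 * y ^ 3 * (3 * lam * (P ^ 2 - R ^ 2) ^ 2 - (6 * β + 2) * (P ^ 2 - R ^ 2)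
          + 4 * (1 - β) * R ^ 2) := by
    simp only [potT, potX, phiTT, phiXX, phiTX, phiT, phiX, ← hP, ← hR, ← hy]; ring
  have hb : 0 ≤ 1 - β := sub_nonneg.2 hβ
  have hRx : 4 * x0 ^ 2 ≤ R ^ 2 := by rw [hR]; nlinarith
  have hbR : (1 - β) * (4 * x0 ^ 2) ≤ (1 - β) * R ^ 2 := mul_le_mul_of_nonneg_left hRx hb
  -- Half of 4(1 - β)R² makes the discriminant nonpositive: (6β + 2)² ≤ 64, whereas 24λ(1 - β)R² ≥
  -- 96 because R² ≥ 4(x⁰)² and λ(1 - β)(x⁰)² ≥ 1. The other half gives the lower bound.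
  have q1 : 0 ≤ 3 * lam * (P ^ 2 - R ^ 2) ^ 2 - (6 * β + 2) * (P ^ 2 - R ^ 2)
      + 2 * (1 - β) * R ^ 2 := by
    have hl : 0 < lam := by
      rcases hlam0.eq_or_lt with h | h
      · rw [← h] at hlam; norm_num at hlam
      · exact h
    generalize P ^ 2 - R ^ 2 = e
    have k1 := mul_le_mul_of_nonneg_left hbR hl.le
    have k2 : (6 * β + 2) ^ 2 ≤ 64 := by nlinarith
    have k3 : 0 ≤ 12 * lam * (3 * lam * e ^ 2 - (6 * β + 2) * e + 2 * (1 - β) * R ^ 2) := by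
      nlinarith [sq_nonneg (6 * lam * e - (6 * β + 2))]
    exact nonneg_of_mul_nonneg_right k3 (by positivity)
  have q2 : 8 * (1 - β) * x0 ^ 2 ≤ 3 * lam * (P ^ 2 - R ^ 2) ^ 2
      - (6 * β + 2) * (P ^ 2 - R ^ 2) + 4 * (1 - β) * R ^ 2 := by linarith
  rw [e1]
  have hy3 : 1 ≤ y ^ 3 := one_le_pow₀ hphi
  have q3 : 0 ≤ 8 * (1 - β) * x0 ^ 2 := by positivity
  calc 8 * (1 - β) * x0 ^ 2 * lam ^ 3 = lam ^ 3 * 1 * (8 * (1 - β) * x0 ^ 2) := by ring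
    _ ≤ _ := mul_le_mul (mul_le_mul_of_nonneg_left hy3 (by positivity)) q2 q3 (by positivity)

end Weight

/-! ### The coefficients of the conjugated operator -/

section Coefficients

variable (x0 β C0 lam : ℝ)

/-- `cosh (σ φₓ)`. -/
noncomputable def coefA (p : ℝ × ℝ × ℝ) : ℝ := Real.cosh (p.1 * phiX x0 β C0 lam p.2.1 p.2.2)

/-- `sinh (σ φₓ) / σ`. -/
noncomputable def coefB (p : ℝ × ℝ × ℝ) : ℝ :=
  phiX x0 β C0 lam p.2.1 p.2.2 * sinhc (p.1 * phiX x0 β C0 lam p.2.1 p.2.2)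

/-- `φₜ² - 2 (cosh (σ φₓ) - 1) / σ²`. -/
noncomputable def coefV (p : ℝ × ℝ × ℝ) : ℝ :=
  phiT x0 β C0 lam p.2.1 p.2.2 ^ 2
    - (phiX x0 β C0 lam p.2.1 p.2.2 * sinhc (p.1 * phiX x0 β C0 lam p.2.1 p.2.2 / 2)) ^ 2

/-- `φ` as a function of `(σ, t, x)`. -/
noncomputable def liftPhi (p : ℝ × ℝ × ℝ) : ℝ := phi x0 β C0 lam p.2.1 p.2.2

/-- `∂ₜφ` as a function of `(σ, t, x)`. -/
noncomputable def liftPhiT (p : ℝ × ℝ × ℝ) : ℝ := phiT x0 β C0 lam p.2.1 p.2.2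

/-- `∂ₓφ` as a function of `(σ, t, x)`. -/
noncomputable def liftPhiX (p : ℝ × ℝ × ℝ) : ℝ := phiX x0 β C0 lam p.2.1 p.2.2

variable {n : WithTop ℕ∞}

theorem contDiff_liftPhi : ContDiff ℝ n (liftPhi x0 β C0 lam) := by
  unfold liftPhi; simp only [phi_eq]; fun_prop

theorem contDiff_liftPhiT : ContDiff ℝ n (liftPhiT x0 β C0 lam) := by
  have := contDiff_liftPhi x0 β C0 lam (n := n)
  unfold liftPhi at this
  unfold liftPhiT; simp only [phiT]; fun_prop

theorem contDiff_liftPhiX : ContDiff ℝ n (liftPhiX x0 β C0 lam) := by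
  have := contDiff_liftPhi x0 β C0 lam (n := n)
  unfold liftPhi at this
  unfold liftPhiX; simp only [phiX]; fun_prop

theorem contDiff_coefA : ContDiff ℝ n (coefA x0 β C0 lam) :=
  Real.contDiff_cosh.comp (contDiff_fst.mul (contDiff_liftPhiX x0 β C0 lam))

theorem contDiff_coefB : ContDiff ℝ n (coefB x0 β C0 lam) :=
  (contDiff_liftPhiX x0 β C0 lam).mul
    (contDiff_sinhc.comp (contDiff_fst.mul (contDiff_liftPhiX x0 β C0 lam)))

theorem contDiff_coefV : ContDiff ℝ n (coefV x0 β C0 lam) :=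
  ((contDiff_liftPhiT x0 β C0 lam).pow 2).sub
    (((contDiff_liftPhiX x0 β C0 lam).mul
      (contDiff_sinhc.comp
        ((contDiff_fst.mul (contDiff_liftPhiX x0 β C0 lam)).div_const 2))).pow 2)

theorem coefA_zero (t x : ℝ) : coefA x0 β C0 lam (0, t, x) = 1 := by simp [coefA]

theorem coefB_zero (t x : ℝ) : coefB x0 β C0 lam (0, t, x) = phiX x0 β C0 lam t x := by
  simp [coefB, sinhc_zero]

theorem coefV_zero (t x : ℝ) : coefV x0 β C0 lam (0, t, x)
    = phiT x0 β C0 lam t x ^ 2 - phiX x0 β C0 lam t x ^ 2 := by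
  simp [coefV, sinhc_zero]

/-- A partial derivative sees only a slice with σ fixed, so at σ = 0 it can be read off from the
explicit limit of the coefficient. -/
theorem partialT_eq_of_hasDerivAt {F : ℝ × ℝ × ℝ → ℝ} (hF : ContDiff ℝ 1 F) {g : ℝ → ℝ}
    {σ t x g' : ℝ} (hFg : ∀ t, F (σ, t, x) = g t) (hg : HasDerivAt g g' t) :
    partialT F (σ, t, x) = g' := by
  have h := hasDerivAt_partialT hF σ t x
  simp only [hFg] at h
  exact h.unique hg

theorem partialX_eq_of_hasDerivAt {F : ℝ × ℝ × ℝ → ℝ} (hF : ContDiff ℝ 1 F) {g : ℝ → ℝ}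
    {σ t x g' : ℝ} (hFg : ∀ x, F (σ, t, x) = g x) (hg : HasDerivAt g g' x) :
    partialX F (σ, t, x) = g' := by
  have h := hasDerivAt_partialX hF σ t x
  simp only [hFg] at h
  exact h.unique hg

end Coefficients

/-! ### Limits of the coefficients at σ = 0 and uniform weight bounds on the grid -/

section Existence

variable (x0 β C0 lam : ℝ)

theorem partialT_coefB (t x : ℝ) :
    partialT (coefB x0 β C0 lam) (0, t, x) = phiTX x0 β C0 lam t x :=
  partialT_eq_of_hasDerivAt (contDiff_coefB ..) (fun _ => coefB_zero ..) (hasDerivAt_phiX_t ..)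

theorem partialX_coefB (t x : ℝ) :
    partialX (coefB x0 β C0 lam) (0, t, x) = phiXX x0 β C0 lam t x :=
  partialX_eq_of_hasDerivAt (contDiff_coefB ..) (fun _ => coefB_zero ..) (hasDerivAt_phiX_x ..)

/-- The product `A φₜ`. -/
noncomputable def coefAT : ℝ × ℝ × ℝ → ℝ := coefA x0 β C0 lam * liftPhiT x0 β C0 lam

/-- The product `A b`. -/
noncomputable def coefAB : ℝ × ℝ × ℝ → ℝ := coefA x0 β C0 lam * coefB x0 β C0 lam

/-- The product `V φₜ`. -/
noncomputable def coefVT : ℝ × ℝ × ℝ → ℝ := coefV x0 β C0 lam * liftPhiT x0 β C0 lam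

/-- The product `V b`. -/
noncomputable def coefVB : ℝ × ℝ × ℝ → ℝ := coefV x0 β C0 lam * coefB x0 β C0 lam

theorem contDiff_coefAT {n : WithTop ℕ∞} : ContDiff ℝ n (coefAT x0 β C0 lam) :=
  (contDiff_coefA ..).mul (contDiff_liftPhiT ..)

theorem contDiff_coefAB {n : WithTop ℕ∞} : ContDiff ℝ n (coefAB x0 β C0 lam) :=
  (contDiff_coefA ..).mul (contDiff_coefB ..)

theorem contDiff_coefVT {n : WithTop ℕ∞} : ContDiff ℝ n (coefVT x0 β C0 lam) :=
  (contDiff_coefV ..).mul (contDiff_liftPhiT ..)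

theorem contDiff_coefVB {n : WithTop ℕ∞} : ContDiff ℝ n (coefVB x0 β C0 lam) :=
  (contDiff_coefV ..).mul (contDiff_coefB ..)

theorem partialT_coefAT (t x : ℝ) :
    partialT (coefAT x0 β C0 lam) (0, t, x) = phiTT x0 β C0 lam t x :=
  partialT_eq_of_hasDerivAt (contDiff_coefAT ..)
    (fun _ => by simp [coefAT, coefA_zero, liftPhiT]) (hasDerivAt_phiT_t ..)

theorem partialX_coefAT (t x : ℝ) :
    partialX (coefAT x0 β C0 lam) (0, t, x) = phiTX x0 β C0 lam t x :=
  partialX_eq_of_hasDerivAt (contDiff_coefAT ..)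
    (fun _ => by simp [coefAT, coefA_zero, liftPhiT]) (hasDerivAt_phiT_x ..)

theorem partialX_coefAB (t x : ℝ) :
    partialX (coefAB x0 β C0 lam) (0, t, x) = phiXX x0 β C0 lam t x :=
  partialX_eq_of_hasDerivAt (contDiff_coefAB ..)
    (fun _ => by simp [coefAB, coefA_zero, coefB_zero]) (hasDerivAt_phiX_x ..)

theorem partialT_coefVT (t x : ℝ) :
    partialT (coefVT x0 β C0 lam) (0, t, x) = potT x0 β C0 lam t x :=
  partialT_eq_of_hasDerivAt (contDiff_coefVT ..)
    (fun _ => by simp [coefVT, coefV_zero, liftPhiT]) (hasDerivAt_potT ..)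

theorem partialX_coefVB (t x : ℝ) :
    partialX (coefVB x0 β C0 lam) (0, t, x) = potX x0 β C0 lam t x :=
  partialX_eq_of_hasDerivAt (contDiff_coefVB ..)
    (fun _ => by simp [coefVB, coefV_zero, coefB_zero]) (hasDerivAt_potX ..)

theorem partialX_liftPhi (p : ℝ × ℝ × ℝ) :
    partialX (liftPhi x0 β C0 lam) p = liftPhiX x0 β C0 lam p :=
  partialX_eq_of_hasDerivAt (contDiff_liftPhi ..) (fun _ => rfl) (hasDerivAt_phi_x ..)

theorem continuous_liftPhiTT :
    Continuous fun p : ℝ × ℝ × ℝ => phiTT x0 β C0 lam p.2.1 p.2.2 := by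
  simp only [phiTT, phi_eq]; fun_prop

/-- Restriction to the grid of a function of `(σ, t, x)`. -/
def onGrid (F : ℝ × ℝ × ℝ → ℝ) (σ t h : ℝ) (j : ℕ) : ℝ := F (σ, t, j * h)

theorem dPlus_onGrid (F : ℝ × ℝ × ℝ → ℝ) (σ t h : ℝ) (j : ℕ) :
    dPlus h (onGrid F σ t h) j = (F (σ, t, j * h + h) - F (σ, t, j * h)) / h := by
  simp only [dPlus, onGrid]; push_cast; rw [add_mul, one_mul]

/-- The `WeightBounds` hypotheses for the Carleman weight at time `t`. -/
def GridWeightBounds (N : ℕ) (h s K c t : ℝ) : Prop :=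
  WeightBounds N h s K c (onGrid (liftPhi x0 β C0 lam) (s * h) t h)
    (onGrid (liftPhiT x0 β C0 lam) (s * h) t h)
    (fun j => phiTT x0 β C0 lam t (j * h))
    (onGrid (liftPhiX x0 β C0 lam) (s * h) t h)
    (onGrid (coefA x0 β C0 lam) (s * h) t h) (onGrid (coefB x0 β C0 lam) (s * h) t h)
    (onGrid (coefV x0 β C0 lam) (s * h) t h)
    (onGrid (partialT (coefB x0 β C0 lam)) (s * h) t h)
    (onGrid (partialT (coefAT x0 β C0 lam)) (s * h) t h)
    (onGrid (partialT (coefVT x0 β C0 lam)) (s * h) t h)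

variable {x0 β C0 lam} {T : ℝ}

/-- Every inequality required is either a bound or a closeness statement for a fixed smooth function
of (σ, t, x) on a compact set, hence uniform in N, h, s and t. Coercivity is that of the continuous
forms, with an eighth of the constant. -/
theorem exists_gridWeightBounds (hβ0 : 0 ≤ β) (hβ : β < 1) (hx0 : x0 < 0)
    (hlam0 : 0 < lam) (hlam : 1 ≤ lam * ((1 - β) * x0 ^ 2))
    (hphi : ∀ t ∈ Icc (-T) T, ∀ x ∈ Icc (0 : ℝ) 1, 1 ≤ phi x0 β C0 lam t x) :
    ∃ K c η : ℝ, 1 ≤ K ∧ 0 < c ∧ 0 < η ∧ ∀ (N : ℕ) (h s t : ℝ), 0 < h → ((N : ℝ) + 1) * h = 1 →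
      h ≤ η → 0 < s → s * h ≤ η → t ∈ Icc (-T) T → GridWeightBounds x0 β C0 lam N h s K c t := by
  have hb : 0 < 1 - β := sub_pos.2 hβ
  set c₀ := min (2 * (1 - β) * lam) (8 * (1 - β) * x0 ^ 2 * lam ^ 3) with hc₀
  have hx2 : 0 < x0 ^ 2 := by have := hx0.ne; positivity
  have hc₀pos : 0 < c₀ := lt_min (by positivity) (by positivity)
  set δ := c₀ / 32 with hδ
  have hδpos : 0 < δ := by positivity
  have hδc : 32 * δ ≤ c₀ := by rw [hδ]; linarith
  obtain ⟨η₁, hη₁, H₁⟩ := exists_abs_sub_le (continuous_liftPhiTT x0 β C0 lam) T hδpos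
  obtain ⟨η₂, hη₂, H₂⟩ := exists_abs_slope_sub_le (contDiff_coefB x0 β C0 lam) T hδpos
  obtain ⟨η₃, hη₃, H₃⟩ := exists_abs_sub_le
    (continuous_partialT (contDiff_coefB x0 β C0 lam)) T hδpos
  obtain ⟨η₄, hη₄, H₄⟩ := exists_abs_slope_sub_le (contDiff_coefAT x0 β C0 lam) T hδpos
  obtain ⟨η₅, hη₅, H₅⟩ := exists_abs_sub_le
    (continuous_partialT (contDiff_coefAT x0 β C0 lam)) T hδpos
  obtain ⟨η₆, hη₆, H₆⟩ := exists_abs_slope_sub_le (contDiff_coefAB x0 β C0 lam) T hδpos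
  obtain ⟨η₇, hη₇, H₇⟩ := exists_abs_sub_le
    (continuous_partialT (contDiff_coefVT x0 β C0 lam)) T hδpos
  obtain ⟨η₈, hη₈, H₈⟩ := exists_abs_slope_sub_le (contDiff_coefVB x0 β C0 lam) T hδpos
  obtain ⟨K₁, B₁⟩ := exists_abs_le (contDiff_liftPhiT x0 β C0 lam (n := 1)).continuous T
  obtain ⟨K₂, B₂⟩ := exists_abs_le (continuous_liftPhiTT x0 β C0 lam) T
  obtain ⟨K₃, B₃⟩ := exists_abs_le (contDiff_liftPhiX x0 β C0 lam (n := 1)).continuous T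
  obtain ⟨K₄, B₄⟩ := exists_abs_slope_le (contDiff_liftPhi x0 β C0 lam) T
  obtain ⟨K₅, B₅⟩ := exists_abs_slope_le (contDiff_liftPhiT x0 β C0 lam) T
  obtain ⟨K₆, B₆⟩ := exists_taylor_le (contDiff_liftPhi x0 β C0 lam)
    (contDiff_liftPhiX x0 β C0 lam) (partialX_liftPhi x0 β C0 lam) T
  obtain ⟨K₇, B₇⟩ := exists_abs_slope_le (contDiff_coefB x0 β C0 lam) T
  obtain ⟨K₈, B₈⟩ := exists_abs_slope_le (contDiff_coefVB x0 β C0 lam) T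
  obtain ⟨K₉, B₉⟩ := exists_abs_le (contDiff_coefAB x0 β C0 lam (n := 1)).continuous T
  obtain ⟨K, hK1, hKs⟩ : ∃ K : ℝ, 1 ≤ K ∧ ∀ k ∈ [K₁, K₂, K₃, K₄, K₅, K₆, K₇, K₈, K₉], k ≤ K := by
    obtain ⟨K, hK⟩ := ([1, K₁, K₂, K₃, K₄, K₅, K₆, K₇, K₈, K₉] : List ℝ).toFinset.bddAbove
    refine ⟨K, hK (by simp), fun k hk => hK ?_⟩
    simp only [Finset.mem_coe, List.mem_toFinset]
    exact List.mem_cons_of_mem _ hk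
  simp only [List.forall_mem_cons, List.not_mem_nil, false_imp_iff, implies_true, and_true] at hKs
  obtain ⟨l₁, l₂, l₃, l₄, l₅, l₆, l₇, l₈, l₉⟩ := hKs
  -- The entry 1 keeps sh in [0,1], the range on which the bounds by K hold.
  refine ⟨K, c₀ / 8, min 1 (min η₁ (min η₂ (min η₃ (min η₄ (min η₅ (min η₆ (min η₇ η₈))))))),
    hK1, by positivity, by positivity, ?_⟩
  intro N h s t hh hNh hhη hs hsh ht
  simp only [le_min_iff] at hhη hsh
  obtain ⟨hh1, h₁, h₂, h₃, h₄, h₅, h₆, h₇, h₈⟩ := hhη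
  obtain ⟨hs1, s₁, s₂, s₃, s₄, s₅, s₆, s₇, s₈⟩ := hsh
  have hσ : 0 < s * h := by positivity
  have hσ' : s * h ∈ Icc (0 : ℝ) 1 := ⟨hσ.le, hs1⟩
  have grid : ∀ j ≤ N + 1, (j : ℝ) * h ∈ Icc (0 : ℝ) 1 := by
    intro j hj
    refine ⟨by positivity, ?_⟩
    rw [← hNh]
    refine mul_le_mul_of_nonneg_right ?_ hh.le
    exact_mod_cast hj
  have cast : ∀ j : ℕ, ((j + 1 : ℕ) : ℝ) * h = j * h + h := by intro j; push_cast; ring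
  have gridr : ∀ j ≤ N, (j : ℝ) * h + h ≤ 1 := by
    intro j hj
    rw [← cast]; exact (grid (j + 1) (by omega)).2
  have gridl : ∀ j : ℕ, 0 ≤ (j : ℝ) * h := fun j => by positivity
  have d0 : ∀ x : ℝ, ∀ η > 0, |x - x| ≤ η := fun x η hη => by simpa using hη.le
  have d1 : ∀ j : ℕ, ∀ η, h ≤ η → |((j + 1 : ℕ) : ℝ) * h - j * h| ≤ η := by
    intro j η hη
    rw [cast, add_sub_cancel_left, abs_of_pos hh]; exact hη
  have slope : ∀ {X k : ℝ}, |X / h| ≤ k → k ≤ K → |X| ≤ K * h := by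
    intro X k h1 h2
    rw [abs_div, abs_of_pos hh] at h1
    exact (div_le_iff₀ hh).1 (h1.trans h2)
  have sinh_eq : ∀ j, s * h * onGrid (coefB x0 β C0 lam) (s * h) t h j
      = Real.sinh (s * h * onGrid (liftPhiX x0 β C0 lam) (s * h) t h j) := by
    intro j
    rw [← mul_sinhc]
    simp only [onGrid, coefB, liftPhiX]; ring
  have rebase : ∀ {a b ε : ℝ} (r : ℝ), b = r → |a - b| ≤ ε → |a - r| ≤ ε := by
    rintro a b ε r rfl h; exact h
  refine ⟨fun j => rfl, sinh_eq, fun j => ?_, fun j hj => ?_, fun j hj => ?_, fun j hj => ?_,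
    fun j hj => ?_, fun j hj => ?_, fun j hj => ?_, fun j hj => ?_, fun j hj => ?_, fun j hj => ?_,
    fun j hj => ?_, fun j hj => ?_, ?_, ?_⟩
  · have := mul_sinhc_half_sq (s * h * phiX x0 β C0 lam t (j * h))
    simp only [onGrid, liftPhiT, coefV, coefA]
    linear_combination this
  · exact (B₁ _ hσ' t ht _ (grid j hj)).trans l₁
  · exact (B₂ _ hσ' t ht _ (grid j hj)).trans l₂
  · exact (B₃ _ hσ' t ht _ (grid j hj)).trans l₃
  · have := slope (B₄ _ hσ' t ht _ _ (gridl j) hh (gridr j hj)) l₄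
    rwa [← cast] at this
  · have := slope (B₅ _ hσ' t ht _ _ (gridl j) hh (gridr j hj)) l₅
    rwa [← cast] at this
  · have := (B₆ _ hσ' t ht _ _ (gridl j) hh (gridr j hj)).1
    rw [← cast] at this
    exact this.trans (mul_le_mul_of_nonneg_right l₆ (sq_nonneg h))
  · have := (B₆ _ hσ' t ht _ _ (gridl j) hh (gridr j hj)).2
    rw [← cast] at this
    exact this.trans (mul_le_mul_of_nonneg_right l₆ (sq_nonneg h))
  · have gj := grid j (by omega)
    have gj' := grid (j + 1) (by omega)
    have hp := gradient_pseudoconvex x0 β C0 lam t (j * h) hβ.le hlam0.le (hphi t ht _ gj)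
    refine gradForm_lower_bound (δ := δ) (ptt := phiTT x0 β C0 lam t (j * h))
      (ptx := phiTX x0 β C0 lam t (j * h)) (pxx := phiXX x0 β C0 lam t (j * h))
      (fun a d => le_trans (mul_le_mul_of_nonneg_right (min_le_left _ _) (by positivity)) (hp a d))
      hδc hδpos.le ?_ ?_ ?_ ?_ ?_ ?_ ?_ ?_ ?_
    · simpa using hδpos.le
    · exact H₁ _ ⟨hσ.le, s₁⟩ t ht _ gj _ gj' (d1 j _ h₁)
    · rw [dPlus_onGrid, ← partialX_coefB]
      exact H₂ _ ⟨hσ.le, s₂⟩ t ht _ _ (gridl j) hh (gridr j hj) h₂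
    · rw [← partialT_coefB]; exact H₃ _ ⟨hσ.le, s₃⟩ t ht _ gj _ gj (d0 _ _ hη₃)
    · rw [← partialT_coefB]; exact H₃ _ ⟨hσ.le, s₃⟩ t ht _ gj _ gj' (d1 j _ h₃)
    -- A product of grid restrictions is definitionally the restriction of the product, so the slope
    -- estimate for `coefAT` applies.
    · refine rebase _ (partialX_coefAT ..) (?_ : |dPlus h (onGrid (coefAT x0 β C0 lam) _ t h) j - _| ≤ _)
      rw [dPlus_onGrid]
      exact H₄ _ ⟨hσ.le, s₄⟩ t ht _ _ (gridl j) hh (gridr j hj) h₄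
    · rw [← partialT_coefAT]; exact H₅ _ ⟨hσ.le, s₅⟩ t ht _ gj _ gj (d0 _ _ hη₅)
    · rw [← partialT_coefAT]; exact H₅ _ ⟨hσ.le, s₅⟩ t ht _ gj _ gj' (d1 j _ h₅)
    · refine rebase _ (partialX_coefAB ..) (?_ : |dPlus h (onGrid (coefAB x0 β C0 lam) _ t h) j - _| ≤ _)
      rw [dPlus_onGrid]
      exact H₆ _ ⟨hσ.le, s₆⟩ t ht _ _ (gridl j) hh (gridr j hj) h₆
  · have gj := grid j (by omega)
    have gj' := grid (j + 1) (by omega)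
    have hp := potential_pseudoconvex x0 β C0 lam t (j * h) hβ0 hβ.le hx0.le gj.1 hlam0.le hlam
      (hphi t ht _ gj)
    refine zeroForm_lower_bound (δ := δ) (le_trans (min_le_right _ _) hp) hδc hδpos.le ?_ ?_ ?_
    · rw [← partialT_coefVT]; exact H₇ _ ⟨hσ.le, s₇⟩ t ht _ gj _ gj (d0 _ _ hη₇)
    · rw [← partialT_coefVT]; exact H₇ _ ⟨hσ.le, s₇⟩ t ht _ gj _ gj' (d1 j _ h₇)
    · refine rebase _ (partialX_coefVB ..) (?_ : |dPlus h (onGrid (coefVB x0 β C0 lam) _ t h) j - _| ≤ _)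
      rw [dPlus_onGrid]
      exact H₈ _ ⟨hσ.le, s₈⟩ t ht _ _ (gridl j) hh (gridr j hj) h₈
  · rw [dPlus_onGrid]
    exact (B₇ _ hσ' t ht _ _ (gridl j) hh (gridr j hj)).trans l₇
  · refine le_trans (?_ : |dPlus h (onGrid (coefVB x0 β C0 lam) (s * h) t h) j| ≤ _) l₈
    rw [dPlus_onGrid]
    exact B₈ _ hσ' t ht _ _ (gridl j) hh (gridr j hj)
  -- At x = 0 the sign of b is that of φₓ = -2λx⁰φ, positive since x⁰ < 0.
  · refine mul_nonneg (Real.cosh_pos _).le (nonneg_of_mul_nonneg_right ?_ hσ)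
    rw [sinh_eq, Real.sinh_nonneg_iff]
    refine mul_nonneg hσ.le ?_
    have := (Real.exp_pos (lam * psi x0 β C0 t (((0 : ℕ) : ℝ) * h))).le
    simp only [onGrid, liftPhiX, phiX, phi]
    refine mul_nonneg (mul_nonneg hlam0.le ?_) this
    simp; linarith
  · exact ((le_abs_self _).trans (B₉ _ hσ' t ht _ (grid (N + 1) le_rfl))).trans l₉

end Existence

/-! ### The energy flux as a function of time -/

/-- The nodal part of the energy flux. -/
noncomputable def fluxNode (h : ℝ) (z u b τ W : ℕ → ℝ) (j : ℕ) : ℝ :=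
  -(τ (j + 1) * u (j + 1) ^ 2) / 2 + b (j + 1) * u (j + 1) * ((z (j + 2) - z j) / (2 * h))
    - W (j + 1) * z (j + 1) ^ 2 / 2

/-- The part of the energy flux living on the mesh intervals. -/
noncomputable def fluxInterval (h : ℝ) (z B : ℕ → ℝ) (j : ℕ) : ℝ :=
  -((B j + B (j + 1)) / 4 * dPlus h z j ^ 2)

theorem hasDerivAt_fluxNode (h : ℝ) {z u b τ W : ℕ → ℝ → ℝ} {v b' τ' W' : ℕ → ℝ} {t : ℝ}
    (hz : ∀ j, HasDerivAt (z j) (u j t) t) (hu : ∀ j, HasDerivAt (u j) (v j) t)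
    (hb : ∀ j, HasDerivAt (b j) (b' j) t) (hτ : ∀ j, HasDerivAt (τ j) (τ' j) t)
    (hW : ∀ j, HasDerivAt (W j) (W' j) t) (j : ℕ) :
    HasDerivAt (fun t => fluxNode h (fun i => z i t) (fun i => u i t) (fun i => b i t)
        (fun i => τ i t) (fun i => W i t) j)
      (fluxNodeDeriv h (fun i => z i t) (fun i => u i t) v (fun i => b i t) (fun i => τ i t)
        (fun i => W i t) b' τ' W' j) t := by
  have h1 := (((hτ (j + 1)).fun_mul ((hu (j + 1)).fun_pow 2)).fun_neg).div_const 2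
  have h2 := ((hb (j + 1)).fun_mul (hu (j + 1))).fun_mul
    (((hz (j + 2)).fun_sub (hz j)).div_const (2 * h))
  have h3 := ((hW (j + 1)).fun_mul ((hz (j + 1)).fun_pow 2)).div_const 2
  refine ((h1.fun_add h2).fun_sub h3).congr_deriv ?_
  simp only [fluxNodeDeriv]
  push_cast
  ring

theorem hasDerivAt_fluxInterval (h : ℝ) {z u B : ℕ → ℝ → ℝ} {B' : ℕ → ℝ} {t : ℝ}
    (hz : ∀ j, HasDerivAt (z j) (u j t) t) (hB : ∀ j, HasDerivAt (B j) (B' j) t) (j : ℕ) :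
    HasDerivAt (fun t => fluxInterval h (fun i => z i t) (fun i => B i t) j)
      (fluxIntervalDeriv h (fun i => z i t) (fun i => u i t) (fun i => B i t) B' j) t := by
  have h1 := ((((hB j).fun_add (hB (j + 1))).div_const 4).fun_mul
    ((((hz (j + 1)).fun_sub (hz j)).div_const h).fun_pow 2)).fun_neg
  refine h1.congr_deriv ?_
  simp only [fluxIntervalDeriv, dPlus]
  push_cast
  ring

theorem absolutelyContinuousOnInterval_finset_sum {ι : Type*} (S : Finset ι) {g : ι → ℝ → ℝ}
    {a b : ℝ} (hg : ∀ i ∈ S, AbsolutelyContinuousOnInterval (g i) a b) :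
    AbsolutelyContinuousOnInterval (fun t => ∑ i ∈ S, g i t) a b := by
  classical
  induction S using Finset.induction_on with
  | empty =>
    simp only [Finset.sum_empty]
    exact (contDiff_const (𝕜 := ℝ)).contDiffOn.absolutelyContinuousOnInterval
  | insert i S hi ih =>
    simp only [Finset.sum_insert hi]
    exact (hg i (Finset.mem_insert_self i S)).fun_add
      (ih fun k hk => hg k (Finset.mem_insert_of_mem hk))

theorem absolutelyContinuousOnInterval_div_const {g : ℝ → ℝ} {a b : ℝ}
    (hg : AbsolutelyContinuousOnInterval g a b) (k : ℝ) :
    AbsolutelyContinuousOnInterval (fun t => g t / k) a b := by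
  simp only [div_eq_inv_mul]
  exact hg.const_mul k⁻¹

theorem absolutelyContinuousOnInterval_sq {g : ℝ → ℝ} {a b : ℝ}
    (hg : AbsolutelyContinuousOnInterval g a b) :
    AbsolutelyContinuousOnInterval (fun t => g t ^ 2) a b := by
  simp only [pow_two]
  exact hg.fun_mul hg

theorem absolutelyContinuousOnInterval_fluxNode (h : ℝ) {z u b τ W : ℕ → ℝ → ℝ} {a₁ a₂ : ℝ}
    (hz : ∀ j, AbsolutelyContinuousOnInterval (z j) a₁ a₂)
    (hu : ∀ j, AbsolutelyContinuousOnInterval (u j) a₁ a₂)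
    (hb : ∀ j, AbsolutelyContinuousOnInterval (b j) a₁ a₂)
    (hτ : ∀ j, AbsolutelyContinuousOnInterval (τ j) a₁ a₂)
    (hW : ∀ j, AbsolutelyContinuousOnInterval (W j) a₁ a₂) (j : ℕ) :
    AbsolutelyContinuousOnInterval (fun t => fluxNode h (fun i => z i t) (fun i => u i t)
      (fun i => b i t) (fun i => τ i t) (fun i => W i t) j) a₁ a₂ := by
  have h1 := absolutelyContinuousOnInterval_div_const
    ((hτ (j + 1)).fun_mul (absolutelyContinuousOnInterval_sq (hu (j + 1)))).fun_neg 2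
  have h2 := ((hb (j + 1)).fun_mul (hu (j + 1))).fun_mul
    (absolutelyContinuousOnInterval_div_const ((hz (j + 2)).fun_sub (hz j)) (2 * h))
  have h3 := absolutelyContinuousOnInterval_div_const
    ((hW (j + 1)).fun_mul (absolutelyContinuousOnInterval_sq (hz (j + 1)))) 2
  exact (h1.fun_add h2).fun_sub h3

theorem absolutelyContinuousOnInterval_fluxInterval (h : ℝ) {z B : ℕ → ℝ → ℝ} {a₁ a₂ : ℝ}
    (hz : ∀ j, AbsolutelyContinuousOnInterval (z j) a₁ a₂)
    (hB : ∀ j, AbsolutelyContinuousOnInterval (B j) a₁ a₂) (j : ℕ) :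
    AbsolutelyContinuousOnInterval
      (fun t => fluxInterval h (fun i => z i t) (fun i => B i t) j) a₁ a₂ :=
  ((absolutelyContinuousOnInterval_div_const ((hB j).fun_add (hB (j + 1))) 4).fun_mul
    (absolutelyContinuousOnInterval_sq
      (absolutelyContinuousOnInterval_div_const ((hz (j + 1)).fun_sub (hz j)) h))).fun_neg

/-- The energy flux. -/
noncomputable def flux (N : ℕ) (h s : ℝ) (f ft A b V w w₁ : ℕ → ℝ) : ℝ :=
  ∑ j ∈ Finset.range N, fluxNode h (conj₀ s f w) (conj₁ s f ft w w₁) (s • b) (s • ft)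
      ((s ^ 2 • V) * (s • ft)) j
    + ∑ j ∈ Finset.range (N + 1), fluxInterval h (conj₀ s f w) (A * (s • ft)) j

theorem flux_eq_zero {N : ℕ} {h s : ℝ} {f ft A b V w w₁ : ℕ → ℝ} (hw : ∀ j, w j = 0)
    (hw₁ : ∀ j, w₁ j = 0) : flux N h s f ft A b V w w₁ = 0 := by
  simp [flux, fluxNode, fluxInterval, conj₀, conj₁, dPlus, hw, hw₁]

/-! ### The flux along the Carleman weight and its time integral -/

section Grid

variable (x0 β C0 lam : ℝ) (N : ℕ) (h s : ℝ) (y y₁ : ℕ → ℝ → ℝ)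

/-- The energy flux on the grid as a function of time. -/
noncomputable def gridFlux (t : ℝ) : ℝ :=
  flux N h s (onGrid (liftPhi x0 β C0 lam) (s * h) t h)
    (onGrid (liftPhiT x0 β C0 lam) (s * h) t h) (onGrid (coefA x0 β C0 lam) (s * h) t h)
    (onGrid (coefB x0 β C0 lam) (s * h) t h) (onGrid (coefV x0 β C0 lam) (s * h) t h)
    (fun j => y j t) (fun j => y₁ j t)

/-- The formal time derivative of the energy flux on the grid. -/
noncomputable def gridFluxDeriv (y₂ : ℕ → ℝ → ℝ) (t : ℝ) : ℝ :=
  fluxDeriv N h s (onGrid (liftPhi x0 β C0 lam) (s * h) t h)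
    (onGrid (liftPhiT x0 β C0 lam) (s * h) t h) (fun j => phiTT x0 β C0 lam t (j * h))
    (onGrid (coefA x0 β C0 lam) (s * h) t h) (onGrid (coefB x0 β C0 lam) (s * h) t h)
    (onGrid (coefV x0 β C0 lam) (s * h) t h)
    (onGrid (partialT (coefB x0 β C0 lam)) (s * h) t h)
    (onGrid (partialT (coefAT x0 β C0 lam)) (s * h) t h)
    (onGrid (partialT (coefVT x0 β C0 lam)) (s * h) t h)
    (fun j => y j t) (fun j => y₁ j t) (fun j => y₂ j t)

variable {y y₁}

theorem hasDerivAt_gridFlux {y₂ : ℕ → ℝ → ℝ} {t : ℝ} (hy : ∀ j, HasDerivAt (y j) (y₁ j t) t)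
    (hy₁ : ∀ j, HasDerivAt (y₁ j) (y₂ j t) t) :
    HasDerivAt (gridFlux x0 β C0 lam N h s y y₁)
      (gridFluxDeriv x0 β C0 lam N h s y y₁ y₂ t) t := by
  have he : ∀ j : ℕ, HasDerivAt (fun t => Real.exp (s * onGrid (liftPhi x0 β C0 lam) (s * h) t h j))
      (Real.exp (s * onGrid (liftPhi x0 β C0 lam) (s * h) t h j)
        * (s * onGrid (liftPhiT x0 β C0 lam) (s * h) t h j)) t := fun j =>
    ((hasDerivAt_phi_t x0 β C0 lam t (j * h)).const_mul s).exp
  have hft : ∀ j : ℕ, HasDerivAt (fun t => s * onGrid (liftPhiT x0 β C0 lam) (s * h) t h j)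
      (s * phiTT x0 β C0 lam t (j * h)) t := fun j =>
    (hasDerivAt_phiT_t x0 β C0 lam t (j * h)).const_mul s
  have hz : ∀ j : ℕ, HasDerivAt
      (fun t => conj₀ s (onGrid (liftPhi x0 β C0 lam) (s * h) t h) (fun j => y j t) j)
      (conj₁ s (onGrid (liftPhi x0 β C0 lam) (s * h) t h)
        (onGrid (liftPhiT x0 β C0 lam) (s * h) t h) (fun j => y j t) (fun j => y₁ j t) j) t := by
    intro j
    refine ((he j).fun_mul (hy j)).congr_deriv ?_
    simp only [conj₁]; ring
  have hu : ∀ j : ℕ, HasDerivAt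
      (fun t => conj₁ s (onGrid (liftPhi x0 β C0 lam) (s * h) t h)
        (onGrid (liftPhiT x0 β C0 lam) (s * h) t h) (fun j => y j t) (fun j => y₁ j t) j)
      (conj₂ s (onGrid (liftPhi x0 β C0 lam) (s * h) t h)
        (onGrid (liftPhiT x0 β C0 lam) (s * h) t h) (fun j => phiTT x0 β C0 lam t (j * h))
        (fun j => y j t) (fun j => y₁ j t) (fun j => y₂ j t) j) t := by
    intro j
    refine ((he j).fun_mul ((hy₁ j).fun_add ((hft j).fun_mul (hy j)))).congr_deriv ?_
    simp only [conj₂]; ring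
  have hb : ∀ j : ℕ, HasDerivAt (fun t => (s • onGrid (coefB x0 β C0 lam) (s * h) t h) j)
      ((s • onGrid (partialT (coefB x0 β C0 lam)) (s * h) t h) j) t := fun j =>
    (hasDerivAt_partialT (contDiff_coefB x0 β C0 lam) (s * h) t (j * h)).const_mul s
  have hB : ∀ j : ℕ, HasDerivAt
      (fun t => (onGrid (coefA x0 β C0 lam) (s * h) t h
        * (s • onGrid (liftPhiT x0 β C0 lam) (s * h) t h)) j)
      ((s • onGrid (partialT (coefAT x0 β C0 lam)) (s * h) t h) j) t := by
    intro j
    refine ((hasDerivAt_partialT (contDiff_coefAT x0 β C0 lam) (s * h) t (j * h)).const_mul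
      s).congr_of_eventuallyEq (Filter.Eventually.of_forall fun t => ?_)
    simp only [Pi.mul_apply, Pi.smul_apply, smul_eq_mul, coefAT, onGrid]; ring
  have hW : ∀ j : ℕ, HasDerivAt
      (fun t => ((s ^ 2 • onGrid (coefV x0 β C0 lam) (s * h) t h)
        * (s • onGrid (liftPhiT x0 β C0 lam) (s * h) t h)) j)
      ((s ^ 3 • onGrid (partialT (coefVT x0 β C0 lam)) (s * h) t h) j) t := by
    intro j
    refine ((hasDerivAt_partialT (contDiff_coefVT x0 β C0 lam) (s * h) t (j * h)).const_mul
      (s ^ 3)).congr_of_eventuallyEq (Filter.Eventually.of_forall fun t => ?_)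
    simp only [Pi.mul_apply, Pi.smul_apply, smul_eq_mul, coefVT, onGrid]; ring
  have hI := hasDerivAt_fluxInterval h
    (u := fun j t => conj₁ s (onGrid (liftPhi x0 β C0 lam) (s * h) t h)
      (onGrid (liftPhiT x0 β C0 lam) (s * h) t h) (fun j => y j t) (fun j => y₁ j t) j) hz hB
  exact (HasDerivAt.fun_sum fun j _ => hasDerivAt_fluxNode h hz hu hb hft hW j).fun_add
    (HasDerivAt.fun_sum fun j _ => hI j)

theorem absolutelyContinuousOnInterval_gridFlux {a₁ a₂ : ℝ}
    (hy : ∀ j, AbsolutelyContinuousOnInterval (y j) a₁ a₂)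
    (hy₁ : ∀ j, AbsolutelyContinuousOnInterval (y₁ j) a₁ a₂) :
    AbsolutelyContinuousOnInterval (gridFlux x0 β C0 lam N h s y y₁) a₁ a₂ := by
  have lift : ∀ {F : ℝ × ℝ × ℝ → ℝ}, ContDiff ℝ 1 F → ∀ j : ℕ,
      AbsolutelyContinuousOnInterval (fun t => onGrid F (s * h) t h j) a₁ a₂ := by
    intro F hF j
    refine ContDiffOn.absolutelyContinuousOnInterval (ContDiff.contDiffOn ?_)
    unfold onGrid
    fun_prop
  have hft := lift (contDiff_liftPhiT x0 β C0 lam)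
  have he : ∀ j : ℕ, AbsolutelyContinuousOnInterval
      (fun t => Real.exp (s * onGrid (liftPhi x0 β C0 lam) (s * h) t h j)) a₁ a₂ := by
    intro j
    exact lift (F := fun p => Real.exp (s * liftPhi x0 β C0 lam p))
      (Real.contDiff_exp.comp (contDiff_const.mul (contDiff_liftPhi x0 β C0 lam))) j
  have hz : ∀ j : ℕ, AbsolutelyContinuousOnInterval
      (fun t => conj₀ s (onGrid (liftPhi x0 β C0 lam) (s * h) t h) (fun j => y j t) j) a₁ a₂ :=
    fun j => (he j).fun_mul (hy j)
  have hu : ∀ j : ℕ, AbsolutelyContinuousOnInterval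
      (fun t => conj₁ s (onGrid (liftPhi x0 β C0 lam) (s * h) t h)
        (onGrid (liftPhiT x0 β C0 lam) (s * h) t h) (fun j => y j t) (fun j => y₁ j t) j) a₁ a₂ :=
    fun j => (he j).fun_mul ((hy₁ j).fun_add (((hft j).const_mul s).fun_mul (hy j)))
  have hb := fun j => (lift (contDiff_coefB x0 β C0 lam) j).const_mul s
  have hτ := fun j => (hft j).const_mul s
  have hB := fun j => (lift (contDiff_coefA x0 β C0 lam) j).fun_mul (hτ j)
  have hW := fun j => ((lift (contDiff_coefV x0 β C0 lam) j).const_mul (s ^ 2)).fun_mul (hτ j)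
  exact (absolutelyContinuousOnInterval_finset_sum _ fun j _ =>
      absolutelyContinuousOnInterval_fluxNode h hz hu hb hτ hW j).fun_add
    (absolutelyContinuousOnInterval_finset_sum _ fun j _ =>
      absolutelyContinuousOnInterval_fluxInterval h hz hB j)

/-- The flux is quadratic in z and ∂ₜz, so it vanishes at ±T. Absolute continuity is enough for the
fundamental theorem of calculus, although ∂ₜₜw exists only almost everywhere. -/
theorem integral_deriv_gridFlux_eq_zero {T : ℝ}
    (hy : ∀ j, AbsolutelyContinuousOnInterval (y j) (-T) T)
    (hy₁ : ∀ j, AbsolutelyContinuousOnInterval (y₁ j) (-T) T)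
    (hl : ∀ j, y j (-T) = 0) (hr : ∀ j, y j T = 0)
    (hl₁ : ∀ j, y₁ j (-T) = 0) (hr₁ : ∀ j, y₁ j T = 0) :
    ∫ t in (-T)..T, deriv (gridFlux x0 β C0 lam N h s y y₁) t = 0 := by
  rw [(absolutelyContinuousOnInterval_gridFlux x0 β C0 lam N h s hy hy₁).integral_deriv_eq_sub,
    gridFlux, gridFlux, flux_eq_zero hr hr₁, flux_eq_zero hl hl₁, sub_zero]

end Grid

/-! ### Extension by zero outside the interior nodes -/

section Extension

variable {N : ℕ} {T : ℝ} {q : ℕ → ℝ} {w : ℕ → ℝ → ℝ}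

/-- The family `w` with all components outside `1, …, N` replaced by zero. -/
def zeroExt (N : ℕ) (w : ℕ → ℝ → ℝ) (j : ℕ) (t : ℝ) : ℝ :=
  if j ∈ Finset.Icc 1 N then w j t else 0

theorem zeroExt_of_mem {j : ℕ} (hj : j ∈ Finset.Icc 1 N) : zeroExt N w j = w j := by
  funext t; simp only [zeroExt, if_pos hj]

theorem zeroExt_of_notMem {j : ℕ} (hj : j ∉ Finset.Icc 1 N) : zeroExt N w j = fun _ => 0 := by
  funext t; simp only [zeroExt, if_neg hj]

theorem dt_zero : dt T (fun _ => 0) = fun _ => 0 := by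
  funext t; simp [dt]

/-- The boundary components of w are prescribed only for t in the open interval, and there a
derivative depends only on the germ. This is why w may be exchanged for its zero extension, which is
regular at every index on the closed interval. -/
theorem dt_congr {f g : ℝ → ℝ} (hfg : EqOn f g (Ioo (-T) T)) :
    EqOn (dt T f) (dt T g) (Ioo (-T) T) := by
  intro t ht
  refine Filter.EventuallyEq.derivWithin_eq (Filter.EventuallyEq.filter_mono ?_ nhdsWithin_le_nhds)
    (hfg ht)
  filter_upwards [isOpen_Ioo.mem_nhds ht] with x hx using hfg hx

theorem Admissible.zeroExt_eqOn (hw : Admissible N T q w) {j : ℕ} (hj : j ≤ N + 1) :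
    EqOn (zeroExt N w j) (w j) (Ioo (-T) T) := by
  intro t ht
  by_cases hm : j ∈ Finset.Icc 1 N
  · rw [zeroExt_of_mem hm]
  · rw [zeroExt_of_notMem hm]
    have : j = 0 ∨ j = N + 1 := by rw [Finset.mem_Icc] at hm; omega
    rcases this with rfl | rfl
    · exact (hw.boundary_left t ht).symm
    · exact (hw.boundary_right t ht).symm

theorem Admissible.waveOp_zeroExt (hw : Admissible N T q w) {j : ℕ} (hj : j ≤ N)
    {t : ℝ} (ht : t ∈ Ioo (-T) T) : waveOp N T q (zeroExt N w) j t = waveOp N T q w j t := by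
  have e0 := hw.zeroExt_eqOn (j := j) (by omega)
  simp only [waveOp, laplacian]
  rw [dt_congr (dt_congr e0) ht, e0 ht, hw.zeroExt_eqOn (j := j + 1) (by omega) ht,
    hw.zeroExt_eqOn (j := j - 1) (by omega) ht]

theorem Admissible.contDiffOn_zeroExt (hw : Admissible N T q w) (j : ℕ) :
    ContDiffOn ℝ 1 (zeroExt N w j) (Icc (-T) T) := by
  by_cases hm : j ∈ Finset.Icc 1 N
  · rw [zeroExt_of_mem hm]; exact hw.contDiffOn j hm
  · rw [zeroExt_of_notMem hm]; exact contDiffOn_const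

theorem Admissible.absCont_zeroExt (hw : Admissible N T q w) (j : ℕ) :
    AbsolutelyContinuousOnInterval (dt T (zeroExt N w j)) (-T) T := by
  by_cases hm : j ∈ Finset.Icc 1 N
  · rw [zeroExt_of_mem hm]; exact hw.absCont j hm
  · rw [zeroExt_of_notMem hm, dt_zero]
    exact contDiffOn_const.absolutelyContinuousOnInterval

theorem Admissible.zeroExt_ends (hw : Admissible N T q w) (j : ℕ) :
    zeroExt N w j (-T) = 0 ∧ zeroExt N w j T = 0
      ∧ dt T (zeroExt N w j) (-T) = 0 ∧ dt T (zeroExt N w j) T = 0 := by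
  by_cases hm : j ∈ Finset.Icc 1 N
  · rw [zeroExt_of_mem hm]
    exact ⟨hw.initial j hm, hw.final j hm, hw.initial_dt j hm, hw.final_dt j hm⟩
  · rw [zeroExt_of_notMem hm, dt_zero]
    exact ⟨rfl, rfl, rfl, rfl⟩

theorem Admissible.hasDerivAt_zeroExt (hw : Admissible N T q w) (j : ℕ) {t : ℝ}
    (ht : t ∈ Ioo (-T) T) : HasDerivAt (zeroExt N w j) (dt T (zeroExt N w j) t) t :=
  (((hw.contDiffOn_zeroExt j).differentiableOn one_ne_zero t
    (Ioo_subset_Icc_self ht)).hasDerivWithinAt).hasDerivAt (Icc_mem_nhds ht.1 ht.2)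

theorem Admissible.ae_hasDerivAt_dt_zeroExt (hw : Admissible N T q w) (hT : 0 < T) :
    ∀ᵐ t, t ∈ Ioo (-T) T → ∀ j,
      HasDerivAt (dt T (zeroExt N w j)) (dt T (dt T (zeroExt N w j)) t) t := by
  have := ae_all_iff.2 fun j => (hw.absCont_zeroExt j).ae_differentiableAt
  filter_upwards [this] with t ht hmem j
  have hd := ht j (by
    rw [uIcc_of_le (by linarith : -T ≤ T)]; exact Ioo_subset_Icc_self hmem)
  exact (hd.differentiableWithinAt.hasDerivWithinAt).hasDerivAt (Icc_mem_nhds hmem.1 hmem.2)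

end Extension

/-! ### Discrete integrals, mesh size and the sup norm -/

theorem intOpen_eq_sum_range (N : ℕ) (g : ℕ → ℝ) :
    intOpen N g = meshSize N * ∑ j ∈ Finset.range N, g (j + 1) := by
  have : Finset.Icc 1 N = Finset.Ico 1 (N + 1) := rfl
  simp only [intOpen, this, Finset.sum_Ico_eq_sum_range, Nat.add_sub_cancel, add_comm 1]

theorem intLeft_eq_sum_range (N : ℕ) (g : ℕ → ℝ) :
    intLeft N g = meshSize N * ∑ j ∈ Finset.range (N + 1), g j := by
  have : Finset.Icc 0 N = Finset.range (N + 1) := by ext; simp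
  rw [intLeft, this]

theorem intervalIntegrable_intOpen {N : ℕ} {a b : ℝ} {g : ℕ → ℝ → ℝ}
    (hg : ∀ j ∈ Finset.Icc 1 N, IntervalIntegrable (g j) volume a b) :
    IntervalIntegrable (fun t => intOpen N fun j => g j t) volume a b := by
  have := (IntervalIntegrable.sum _ hg).const_mul (meshSize N)
  simpa only [intOpen, Finset.sum_apply] using this

theorem intervalIntegrable_intLeft {N : ℕ} {a b : ℝ} {g : ℕ → ℝ → ℝ}
    (hg : ∀ j ∈ Finset.Icc 0 N, IntervalIntegrable (g j) volume a b) :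
    IntervalIntegrable (fun t => intLeft N fun j => g j t) volume a b := by
  have := (IntervalIntegrable.sum _ hg).const_mul (meshSize N)
  simpa only [intLeft, Finset.sum_apply] using this

theorem meshSize_pos (N : ℕ) : 0 < meshSize N := by unfold meshSize; positivity

theorem succ_mul_meshSize (N : ℕ) : ((N : ℝ) + 1) * meshSize N = 1 :=
  mul_one_div_cancel (by positivity)

/-- The index set is finite, so the family is bounded above and the real supremum really dominates
each entry. -/
theorem abs_le_of_normLinf_le {N : ℕ} {q : ℕ → ℝ} {m : ℝ} (hq : normLinf N q ≤ m) {j : ℕ}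
    (hj : j ∈ Finset.Icc 1 N) : |q j| ≤ m :=
  (le_ciSup (f := fun i : Finset.Icc 1 N => |q i|) (finite_range _).bddAbove ⟨j, hj⟩).trans hq

/-! ### Integration in time -/

section Integration

variable {x0 β C0 lam T : ℝ} {N : ℕ} {q : ℕ → ℝ} {w : ℕ → ℝ → ℝ}

theorem continuous_weight (s x : ℝ) :
    Continuous fun t => Real.exp (2 * s * phi x0 β C0 lam t x) := by
  simp only [phi_eq]; fun_prop

/-- Integration in time of the pointwise Carleman inequality, for the extension by zero. -/
theorem Admissible.integrated_carleman (hw : Admissible N T q w) (hT : 0 < T) {s κ M : ℝ}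
    (hpt : ∀ t ∈ Ioo (-T) T, ∀ y y₁ y₂ : ℕ → ℝ → ℝ,
      y 0 t = 0 → y (N + 1) t = 0 → y₁ 0 t = 0 → y₁ (N + 1) t = 0 →
      s * ∑ j ∈ Finset.range N, Real.exp (2 * s * phi x0 β C0 lam t ((j + 1 : ℕ) * meshSize N))
              * y₁ (j + 1) t ^ 2
          + s * ∑ j ∈ Finset.range (N + 1), Real.exp (2 * s * phi x0 β C0 lam t (j * meshSize N))
              * dPlus (meshSize N) (fun i => y i t) j ^ 2
          + s ^ 3 * ∑ j ∈ Finset.range N,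
              Real.exp (2 * s * phi x0 β C0 lam t ((j + 1 : ℕ) * meshSize N)) * y (j + 1) t ^ 2
          + κ * gridFluxDeriv x0 β C0 lam N (meshSize N) s y y₁ y₂ t
        ≤ M * ∑ j ∈ Finset.range N,
              Real.exp (2 * s * phi x0 β C0 lam t ((j + 1 : ℕ) * meshSize N))
              * (y₂ (j + 1) t - laplacian (meshSize N) (fun i => y i t) (j + 1)
                  + q (j + 1) * y (j + 1) t) ^ 2
          + M * s * (Real.exp (2 * s * phi x0 β C0 lam t ((N + 1 : ℕ) * meshSize N))
              * dPlus (meshSize N) (fun i => y i t) N ^ 2) / meshSize N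
          + M * s * ∑ j ∈ Finset.range (N + 1),
              Real.exp (2 * s * phi x0 β C0 lam t (j * meshSize N))
                * (y₁ (j + 1) t - y₁ j t) ^ 2) :
    s * (∫ t in (-T)..T, intOpen N (fun j =>
          Real.exp (2 * s * phi x0 β C0 lam t (j * meshSize N)) * |dt T (w j) t| ^ 2))
      + s * (∫ t in (-T)..T, intLeft N (fun j =>
          Real.exp (2 * s * phi x0 β C0 lam t (j * meshSize N))
            * |dPlus (meshSize N) (fun i => w i t) j| ^ 2))
      + s ^ 3 * (∫ t in (-T)..T, intOpen N (fun j =>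
          Real.exp (2 * s * phi x0 β C0 lam t (j * meshSize N)) * |w j t| ^ 2))
    ≤ M * (∫ t in (-T)..T, intOpen N (fun j =>
          Real.exp (2 * s * phi x0 β C0 lam t (j * meshSize N)) * |waveOp N T q w j t| ^ 2))
      + M * s * (∫ t in (-T)..T,
          Real.exp (2 * s * phi x0 β C0 lam t 1)
            * |dMinus (meshSize N) (fun i => w i t) (N + 1)| ^ 2)
      + M * s * (∫ t in (-T)..T, intLeft N (fun j =>
          Real.exp (2 * s * phi x0 β C0 lam t (j * meshSize N))
            * |meshSize N * dPlus (meshSize N) (fun i => dt T (w i) t) j| ^ 2)) := by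
  have hTT : -T ≤ T := by linarith
  have hu : uIcc (-T) T = Icc (-T) T := uIcc_of_le hTT
  have hh := meshSize_pos N
  set h := meshSize N with hhdef
  set y := zeroExt N w with hy
  have cy : ∀ j, ContinuousOn (y j) (uIcc (-T) T) := fun j => by
    rw [hu]; exact (hw.contDiffOn_zeroExt j).continuousOn
  have cy₁ : ∀ j, ContinuousOn (dt T (y j)) (uIcc (-T) T) := fun j =>
    (hw.absCont_zeroExt j).continuousOn
  have ce : ∀ x, ContinuousOn (fun t => Real.exp (2 * s * phi x0 β C0 lam t x)) (uIcc (-T) T) :=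
    fun x => (continuous_weight s x).continuousOn
  have ey : ∀ j ≤ N + 1, EqOn (w j) (y j) (Ioo (-T) T) := fun j hj => (hw.zeroExt_eqOn hj).symm
  have ey₁ : ∀ j ≤ N + 1, EqOn (dt T (w j)) (dt T (y j)) (Ioo (-T) T) := fun j hj =>
    dt_congr (ey j hj)
  -- All integrals except that of the operator are rewritten for the zero extension; agreement on
  -- the open interval suffices.
  rw [intervalIntegral.integral_congr_Ioo_of_le hTT
      (f := fun t => intOpen N fun j => Real.exp (2 * s * phi x0 β C0 lam t (j * h)) * |dt T (w j) t| ^ 2)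
      (g := fun t => intOpen N fun j => Real.exp (2 * s * phi x0 β C0 lam t (j * h)) * dt T (y j) t ^ 2) ?A,
    intervalIntegral.integral_congr_Ioo_of_le hTT
      (f := fun t => intLeft N fun j => Real.exp (2 * s * phi x0 β C0 lam t (j * h)) * |dPlus h (fun i => w i t) j| ^ 2)
      (g := fun t => intLeft N fun j => Real.exp (2 * s * phi x0 β C0 lam t (j * h)) * dPlus h (fun i => y i t) j ^ 2) ?B,
    intervalIntegral.integral_congr_Ioo_of_le hTT
      (f := fun t => intOpen N fun j => Real.exp (2 * s * phi x0 β C0 lam t (j * h)) * |w j t| ^ 2)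
      (g := fun t => intOpen N fun j => Real.exp (2 * s * phi x0 β C0 lam t (j * h)) * y j t ^ 2) ?C,
    intervalIntegral.integral_congr_Ioo_of_le hTT
      (f := fun t => Real.exp (2 * s * phi x0 β C0 lam t 1)
        * |dMinus h (fun i => w i t) (N + 1)| ^ 2)
      (g := fun t => Real.exp (2 * s * phi x0 β C0 lam t 1) * dPlus h (fun i => y i t) N ^ 2) ?D,
    intervalIntegral.integral_congr_Ioo_of_le hTT
      (f := fun t => intLeft N fun j => Real.exp (2 * s * phi x0 β C0 lam t (j * h)) *
        |h * dPlus h (fun i => dt T (w i) t) j| ^ 2)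
      (g := fun t => intLeft N fun j => Real.exp (2 * s * phi x0 β C0 lam t (j * h)) *
        (dt T (y (j + 1)) t - dt T (y j) t) ^ 2) ?E]
  case A =>
    intro t ht
    simp only [intOpen, sq_abs]
    congr 1
    refine Finset.sum_congr rfl fun j hj => ?_
    rw [ey₁ j (by rw [Finset.mem_Icc] at hj; omega) ht]
  case B =>
    intro t ht
    simp only [intLeft, sq_abs, dPlus]
    congr 1
    refine Finset.sum_congr rfl fun j hj => ?_
    rw [Finset.mem_Icc] at hj
    rw [ey j (by omega) ht, ey (j + 1) (by omega) ht]
  case C =>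
    intro t ht
    simp only [intOpen, sq_abs]
    congr 1
    refine Finset.sum_congr rfl fun j hj => ?_
    rw [ey j (by rw [Finset.mem_Icc] at hj; omega) ht]
  case D =>
    intro t ht
    simp only [sq_abs, dPlus, dMinus, Nat.add_sub_cancel]
    rw [ey N (by omega) ht, ey (N + 1) le_rfl ht]
  case E =>
    intro t ht
    simp only [intLeft, sq_abs, dPlus]
    congr 1
    refine Finset.sum_congr rfl fun j hj => ?_
    rw [Finset.mem_Icc] at hj
    rw [ey₁ j (by omega) ht, ey₁ (j + 1) (by omega) ht, mul_div_cancel₀ _ hh.ne']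
  set Φ := gridFlux x0 β C0 lam N h s y (fun j => dt T (y j)) with hΦ
  have acy : ∀ j, AbsolutelyContinuousOnInterval (y j) (-T) T := fun j =>
    ContDiffOn.absolutelyContinuousOnInterval (by rw [hu]; exact hw.contDiffOn_zeroExt j)
  have acΦ : AbsolutelyContinuousOnInterval Φ (-T) T :=
    absolutelyContinuousOnInterval_gridFlux x0 β C0 lam N h s acy hw.absCont_zeroExt
  have zΦ : ∫ t in (-T)..T, deriv Φ t = 0 :=
    integral_deriv_gridFlux_eq_zero x0 β C0 lam N h s acy hw.absCont_zeroExt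
      (fun j => (hw.zeroExt_ends j).1) (fun j => (hw.zeroExt_ends j).2.1)
      (fun j => (hw.zeroExt_ends j).2.2.1) (fun j => (hw.zeroExt_ends j).2.2.2)
  have i1 : IntervalIntegrable (fun t => intOpen N fun j =>
      Real.exp (2 * s * phi x0 β C0 lam t (j * h)) * dt T (y j) t ^ 2) volume (-T) T :=
    intervalIntegrable_intOpen fun j _ => ((ce _).mul ((cy₁ j).pow 2)).intervalIntegrable
  have i2 : IntervalIntegrable (fun t => intLeft N fun j =>
      Real.exp (2 * s * phi x0 β C0 lam t (j * h)) * dPlus h (fun i => y i t) j ^ 2)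
      volume (-T) T :=
    intervalIntegrable_intLeft fun j _ => ((ce _).mul
      ((((cy (j + 1)).sub (cy j)).div_const h).pow 2)).intervalIntegrable
  have i3 : IntervalIntegrable (fun t => intOpen N fun j =>
      Real.exp (2 * s * phi x0 β C0 lam t (j * h)) * y j t ^ 2) volume (-T) T :=
    intervalIntegrable_intOpen fun j _ => ((ce _).mul ((cy j).pow 2)).intervalIntegrable
  -- Second time derivatives enter only through `deriv Φ`, integrable because Φ is absolutely
  -- continuous, and through the operator, which is square integrable by assumption.
  have i4 : IntervalIntegrable (deriv Φ) volume (-T) T := acΦ.intervalIntegrable_deriv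
  have i5 : IntervalIntegrable (fun t => intOpen N fun j =>
      Real.exp (2 * s * phi x0 β C0 lam t (j * h)) * |waveOp N T q w j t| ^ 2) volume (-T) T := by
    refine intervalIntegrable_intOpen fun j hj => IntervalIntegrable.continuousOn_mul ?_ (ce _)
    rw [intervalIntegrable_iff_integrableOn_Ioo_of_le hTT]
    simp only [sq_abs]
    exact (hw.memLp j hj).integrable_sq
  have i6 : IntervalIntegrable (fun t => Real.exp (2 * s * phi x0 β C0 lam t 1)
      * dPlus h (fun i => y i t) N ^ 2) volume (-T) T :=
    ((ce _).mul ((((cy (N + 1)).sub (cy N)).div_const h).pow 2)).intervalIntegrable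
  have i7 : IntervalIntegrable (fun t => intLeft N fun j =>
      Real.exp (2 * s * phi x0 β C0 lam t (j * h)) * (dt T (y (j + 1)) t - dt T (y j) t) ^ 2)
      volume (-T) T :=
    intervalIntegrable_intLeft fun j _ => ((ce _).mul
      (((cy₁ (j + 1)).sub (cy₁ j)).pow 2)).intervalIntegrable
  have j1 := i1.const_mul s
  have j2 := i2.const_mul s
  have j3 := i3.const_mul (s ^ 3)
  have j4 := i4.const_mul (h * κ)
  have j5 := i5.const_mul M
  have j6 := i6.const_mul (M * s)
  have j7 := i7.const_mul (M * s)
  have mono := intervalIntegral.integral_mono_ae_restrict hTT (((j1.add j2).add j3).add j4)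
    ((j5.add j6).add j7) ?_
  · rw [intervalIntegral.integral_add ((j1.add j2).add j3) j4,
      intervalIntegral.integral_add (j1.add j2) j3, intervalIntegral.integral_add j1 j2,
      intervalIntegral.integral_add (j5.add j6) j7, intervalIntegral.integral_add j5 j6] at mono
    simp only [intervalIntegral.integral_const_mul] at mono
    rw [zΦ, mul_zero, add_zero] at mono
    exact mono
  · refine (ae_restrict_iff' measurableSet_Icc).2 ?_
    filter_upwards [hw.ae_hasDerivAt_dt_zeroExt hT, Measure.ae_ne volume (-T),
      Measure.ae_ne volume T] with t h2 hl hr hmem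
    have ht : t ∈ Ioo (-T) T := ⟨lt_of_le_of_ne hmem.1 (Ne.symm hl), lt_of_le_of_ne hmem.2 hr⟩
    have dΦ : deriv Φ t = gridFluxDeriv x0 β C0 lam N h s y (fun j => dt T (y j))
        (fun j => dt T (dt T (y j))) t :=
      (hasDerivAt_gridFlux x0 β C0 lam N h s (fun j => hw.hasDerivAt_zeroExt j ht)
        (h2 ht)).deriv
    have n0 : 0 ∉ Finset.Icc 1 N := by simp
    have n1 : N + 1 ∉ Finset.Icc 1 N := by simp
    have p := hpt t ht y (fun j => dt T (y j)) (fun j => dt T (dt T (y j)))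
      (by rw [hy, zeroExt_of_notMem n0]) (by rw [hy, zeroExt_of_notMem n1])
      (by simp only [hy, zeroExt_of_notMem n0, dt_zero])
      (by simp only [hy, zeroExt_of_notMem n1, dt_zero])
    have e1 : ((N + 1 : ℕ) : ℝ) * h = 1 := by push_cast; exact succ_mul_meshSize N
    rw [e1, ← dΦ] at p
    -- The factor h turns the sums into discrete integrals and cancels the 1/h of the boundary term.
    have p' := mul_le_mul_of_nonneg_left p hh.le
    have eL : intOpen N (fun j =>
        Real.exp (2 * s * phi x0 β C0 lam t (j * h)) * |waveOp N T q w j t| ^ 2)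
        = h * ∑ j ∈ Finset.range N, Real.exp (2 * s * phi x0 β C0 lam t ((j + 1 : ℕ) * h))
              * (dt T (dt T (y (j + 1))) t - laplacian h (fun i => y i t) (j + 1)
                  + q (j + 1) * y (j + 1) t) ^ 2 := by
      rw [intOpen_eq_sum_range]
      congr 1
      refine Finset.sum_congr rfl fun j hj => ?_
      rw [sq_abs, ← hw.waveOp_zeroExt (by have := Finset.mem_range.1 hj; omega) ht]
      rfl
    rw [eL, intOpen_eq_sum_range, intOpen_eq_sum_range, intLeft_eq_sum_range,
      intLeft_eq_sum_range, ← hhdef]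
    have eD : h * (M * s * (Real.exp (2 * s * phi x0 β C0 lam t 1)
        * dPlus h (fun i => y i t) N ^ 2) / h)
        = M * s * (Real.exp (2 * s * phi x0 β C0 lam t 1) * dPlus h (fun i => y i t) N ^ 2) :=
      mul_div_cancel₀ _ hh.ne'
    rw [mul_add, mul_add, mul_add, mul_add, mul_add, eD] at p'
    linarith

end Integration

end DiscreteCarleman

/-! ### Choice of the constants and conclusion -/

open DiscreteCarleman

theorem corollary2p3 (T β x0 C0 m : ℝ) (hT : 0 < T) (hβ : β ∈ Set.Ioo (0 : ℝ) 1)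
    (hx0 : x0 < 0) (hC0 : 0 < C0)
    (hpsi : ∀ t ∈ Set.Icc (-T) T, ∀ x ∈ Set.Icc (0 : ℝ) 1, 1 ≤ psi x0 β C0 t x)
    (hm : 0 < m) :
    ∃ s0 lam ε h0 M : ℝ, 0 < s0 ∧ 0 < lam ∧ 0 < ε ∧ 0 < h0 ∧ 0 < M ∧
      ∀ (N : ℕ) (h : ℝ), h = meshSize N → h < h0 →
      ∀ q : ℕ → ℝ, normLinf N q ≤ m →
      ∀ s ∈ Set.Ioo s0 (ε / h),
      ∀ w : ℕ → ℝ → ℝ, Admissible N T q w →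
        s * (∫ t in (-T)..T, intOpen N (fun j =>
              Real.exp (2 * s * phi x0 β C0 lam t (j * h)) * |dt T (w j) t| ^ 2))
          + s * (∫ t in (-T)..T, intLeft N (fun j =>
              Real.exp (2 * s * phi x0 β C0 lam t (j * h))
                * |dPlus h (fun i => w i t) j| ^ 2))
          + s ^ 3 * (∫ t in (-T)..T, intOpen N (fun j =>
              Real.exp (2 * s * phi x0 β C0 lam t (j * h)) * |w j t| ^ 2))
        ≤ M * (∫ t in (-T)..T, intOpen N (fun j =>
              Real.exp (2 * s * phi x0 β C0 lam t (j * h)) * |waveOp N T q w j t| ^ 2))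
          + M * s * (∫ t in (-T)..T,
              Real.exp (2 * s * phi x0 β C0 lam t 1)
                * |dMinus h (fun i => w i t) (N + 1)| ^ 2)
          + M * s * (∫ t in (-T)..T, intLeft N (fun j =>
              Real.exp (2 * s * phi x0 β C0 lam t (j * h))
                * |h * dPlus h (fun i => dt T (w i) t) j| ^ 2)) := by
  have hb : 0 < 1 - β := sub_pos.2 hβ.2
  have hx2 : 0 < x0 ^ 2 := by have := hx0.ne; positivity
  -- This λ gives equality in the condition 1 ≤ λ(1 - β)(x⁰)² of `potential_pseudoconvex`.
  have hlam0 : 0 < 1 / ((1 - β) * x0 ^ 2) := by positivity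
  have hphi : ∀ t ∈ Set.Icc (-T) T, ∀ x ∈ Set.Icc (0 : ℝ) 1,
      1 ≤ phi x0 β C0 (1 / ((1 - β) * x0 ^ 2)) t x := fun t ht x hx =>
    Real.one_le_exp (mul_nonneg hlam0.le (zero_le_one.trans (hpsi t ht x hx)))
  obtain ⟨K, c, η₁, hK, hc, hη₁, hbounds⟩ := exists_gridWeightBounds hβ.1.le hβ.2 hx0 hlam0
    (one_div_mul_cancel (by positivity)).ge hphi
  obtain ⟨s₀, η₂, κ, M, hs₀, hη₂, -, hM, hpoint⟩ := exists_pointwise_carleman hK hc hm.le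
  -- ε bounds sh, both for the closeness of the forms to their limits and for the absorption of the
  -- errors; h itself must also be below η₁ for the former.
  refine ⟨s₀, 1 / ((1 - β) * x0 ^ 2), min η₁ η₂, η₁, M, hs₀, hlam0, lt_min hη₁ hη₂, hη₁, hM, ?_⟩
  rintro N h rfl hh q hq s ⟨hs, hs'⟩ w hw
  have hpos := meshSize_pos N
  have hs0 : 0 < s := hs₀.trans hs
  rw [lt_div_iff₀ hpos] at hs'
  refine hw.integrated_carleman hT (κ := κ) fun t ht y y₁ y₂ h0 h1 h2 h3 => ?_
  have hW := hbounds N (meshSize N) s t hpos (succ_mul_meshSize N) hh.le hs0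
    (hs'.le.trans (min_le_left _ _)) (Set.Ioo_subset_Icc_self ht)
  unfold GridWeightBounds at hW
  have p := hpoint N (meshSize N) s _ _ _ _ _ _ _ _ _ _ hpos hs.le
    (hs'.le.trans (min_le_right _ _)) hW q (fun j => y j t) (fun j => y₁ j t) (fun j => y₂ j t)
    (fun j hj => abs_le_of_normLinf_le hq (Finset.mem_Icc.2 ⟨by omega, by omega⟩)) h0 h1 h2 h3
  exact p
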